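/- Let $A$ be a ring with identity, let $\mathrm{Mod}\text{-}A$ be the category of right $A$-modules and $\mathrm{mod}\text{-}A$ its full subcategory of finitely presented modules. A full subcategory of $\mathrm{Mod}\text{-}A$ is called definable if it is closed under direct products, direct limits and pure subobjects. Let $\mathrm{mod}\text{-}(\mathrm{mod}\text{-}A)$ be the abelian category of finitely presented functors $F:\mathrm{mod}\text{-}A\to\mathrm{Ab}$, that is, functors admitting a sequence $\mathrm{Hom}_A(Y,-)\to\mathrm{Hom}_A(X,-)\to F\to 0$ with $X,Y\in\mathrm{mod}\text{-}A$ which is exact at every object; for such $F$ let $\overrightarrow{F}:\mathrm{Mod}\text{-}A\to\mathrm{Ab}$ be the unique extension of $F$ that commutes with direct limits, and let $\mathrm{Ker}(\overrightarrow F)=\{M\in\mathrm{Mod}\text{-}A\mid\overrightarrow F(M)=0\}$. Let $\mathbb{A}$ be the full subcategory of $\mathrm{mod}\text{-}A$ with objects $0,A,A^2,A^3,\dots$, and let $\mathrm{III}(\mathbb{A})$ be Adelman's abelian category over $\mathbb{A}$: its objects are the chains $X_1\xrightarrow{f_1}X_2\xrightarrow{f_2}X_3$ in $\mathbb{A}$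 (not necessarily complexes), and its morphisms from this chain to $Y_1\xrightarrow{g_1}Y_2\xrightarrow{g_2}Y_3$ are the commutative diagrams $(\alpha_1,\alpha_2,\alpha_3)$ modulo those for which $\alpha_2=g_1s+tf_2$ for some $s:X_2\to Y_1$ and $t:X_3\to Y_2$. For an object $\mathbf{A}=(A^n\xrightarrow{u}A^m\xrightarrow{v}A^p)$ of $\mathrm{III}(\mathbb{A})$ put $$\Omega_{\mathbf A}=\{M\in\mathrm{Mod}\text{-}A\mid \text{for every }\alpha:A^m\to M\text{ with }\alpha u=0\text{ there is }\beta:A^p\to M\text{ with }\alpha=\beta v\}.$$ A Serre subcategory of an abelian category is a full subcategory that contains the zero object and is closed under subobjects, quotients and extensions. Then: (1) For every Serre subcategory $\mathcal S$ of $\mathrm{mod}\text{-}(\mathrm{mod}\text{-}A)$ the subcategory $\bigcap_{F\in\mathcal S}\mathrm{Ker}(\overrightarrow F)$ of $\mathrm{Mod}\text{-}A$ is definable, and $\mathcal S\mapsto\bigcap_{F\in\mathcal S}\mathrm{Ker}(\overrightarrow F)$ is a bijection from the Serre subcategories of $\mathrm{mod}\text{-}(\mathrm{mod}\text{-}A)$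 onto the definable subcategories of $\mathrm{Mod}\text{-}A$. (2) For every Serre subcategory $\mathscr S$ of $\mathrm{III}(\mathbb{A})$ the subcategory $\bigcap_{\mathbf A\in\mathscr S}\Omega_{\mathbf A}$ of $\mathrm{Mod}\text{-}A$ is definable, and $\mathscr S\mapsto\bigcap_{\mathbf A\in\mathscr S}\Omega_{\mathbf A}$ is a bijection from the Serre subcategories of $\mathrm{III}(\mathbb{A})$ onto the definable subcategories of $\mathrm{Mod}\text{-}A$. (3) Both bijections reverse inclusions: for Serre subcategories $\mathcal S,\mathcal S'$ of the respective category, $\mathcal S\subseteq\mathcal S'$ if and only if the definable subcategory of $\mathcal S'$ is contained in that of $\mathcal S$. -/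

import Mathlib

open CategoryTheory CategoryTheory.Limits MulOpposite

universe u v

namespace FreeAb

/-! ### Modules -/

/-- `Mod-A`: right `A`-modules, that is, modules over `Aᵐᵒᵖ` (`op a • x` is `x a`). -/
abbrev RMod (A : Type u) [Ring A] : Type (u + 1) := ModuleCat.{u} Aᵐᵒᵖ

/-- The class of finitely presented right `A`-modules. -/
def isFinPres (A : Type u) [Ring A] : ObjectProperty (RMod A) :=
  fun M => Module.FinitePresentation Aᵐᵒᵖ M

/-- `mod-A`: the full subcategory of finitely presented right `A`-modules. -/
abbrev FPMod (A : Type u) [Ring A] : Type (u + 1) := (isFinPres A).FullSubcategory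

/-- A homomorphism `f : M ⟶ N` of right modules is a pure monomorphism if it is injective and
every finite system of linear equations `∑ i, yᵢ Uᵢⱼ = xⱼ` with constants `xⱼ` in `M` which has a
solution in `N` has a solution in `M`. -/
def IsPureMono {A : Type u} [Ring A] {M N : RMod A} (f : M ⟶ N) : Prop :=
  Function.Injective f ∧
    ∀ (m n : ℕ) (U : Matrix (Fin m) (Fin n) A) (x : Fin n → M),
      (∃ y : Fin m → N, ∀ j, ∑ i, op (U i j) • y i = f (x j)) →
        ∃ z : Fin m → M, ∀ j, ∑ i, op (U i j) • z i = x j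

/-- A (full) subcategory of `Mod-A` is definable if it is closed under direct products,
direct limits (colimits over non-empty directed posets) and pure subobjects. -/
structure IsDefinable {A : Type u} [Ring A] (D : ObjectProperty (RMod A)) : Prop where
  products : ∀ ι : Type u, D.IsClosedUnderLimitsOfShape (Discrete ι)
  directLimits : ∀ (J : Type u) [PartialOrder J] [IsDirectedOrder J] [Nonempty J],
    D.IsClosedUnderColimitsOfShape J
  pureSubobjects : ∀ {M N : RMod A} (f : M ⟶ N), IsPureMono f → D N → D M

/-! ### Serre subcategories -/

/-- A (full) subcategory is a Serre subcategory if it contains a zero object and is closed under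
subobjects, quotients and extensions. For an abelian category this is
`CategoryTheory.ObjectProperty.IsSerreClass`, see `isSerre_iff`. -/
structure IsSerre {C : Type u} [Category.{v} C] [HasZeroMorphisms C]
    (S : ObjectProperty C) : Prop where
  containsZero : S.ContainsZero
  subobjects : S.IsClosedUnderSubobjects
  quotients : S.IsClosedUnderQuotients
  extensions : S.IsClosedUnderExtensions

theorem isSerre_iff {C : Type u} [Category.{v} C] [Abelian C] (S : ObjectProperty C) :
    IsSerre S ↔ S.IsSerreClass :=
  ⟨fun h => { toContainsZero := h.1, toIsClosedUnderSubobjects := h.2,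
              toIsClosedUnderQuotients := h.3, toIsClosedUnderExtensions := h.4 },
    fun h => ⟨h.toContainsZero, h.toIsClosedUnderSubobjects, h.toIsClosedUnderQuotients,
      h.toIsClosedUnderExtensions⟩⟩

/-! ### Finitely presented functors on `mod-A` and their extensions to `Mod-A` -/

/-- A functor `F : mod-A ⥤ Ab` is finitely presented if there is a sequence
`Hom(Y, -) ⟶ Hom(X, -) ⟶ F ⟶ 0` with `X, Y` in `mod-A` which is exact at every object. -/
def isFinPresFunctor (A : Type u) [Ring A] : ObjectProperty (FPMod A ⥤ AddCommGrpCat.{u}) :=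
  fun F => ∃ (X Y : FPMod A)
    (φ : preadditiveCoyoneda.obj (Opposite.op Y) ⟶ preadditiveCoyoneda.obj (Opposite.op X))
    (π : preadditiveCoyoneda.obj (Opposite.op X) ⟶ F),
    ∀ Z : FPMod A, Function.Exact (φ.app Z) (π.app Z) ∧ Function.Surjective (π.app Z)

/-- `mod-(mod-A)`: the category of finitely presented functors `mod-A ⥤ Ab`. -/
abbrev FPFun (A : Type u) [Ring A] : Type (u + 1) := (isFinPresFunctor A).FullSubcategory

instance essentiallySmall_isFinPres (A : Type u) [Ring A] :
    ObjectProperty.EssentiallySmall.{u} (isFinPres A) where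
  exists_small_le' := by
    refine ⟨.ofObj (fun p : Σ n : ℕ, Submodule Aᵐᵒᵖ (Fin n → Aᵐᵒᵖ) =>
      ModuleCat.of Aᵐᵒᵖ ((Fin p.1 → Aᵐᵒᵖ) ⧸ p.2)), inferInstance, ?_⟩
    intro M hM
    have : Module.FinitePresentation Aᵐᵒᵖ M := hM
    obtain ⟨n, K, e, -⟩ := Module.FinitePresentation.exists_fin Aᵐᵒᵖ M
    exact ⟨_, ⟨⟨n, K⟩⟩, ⟨e.toModuleIso⟩⟩

instance hasPointwiseLeftKanExtension (A : Type u) [Ring A] (F : FPMod A ⥤ AddCommGrpCat.{u}) :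
    (isFinPres A).ι.HasPointwiseLeftKanExtension F := fun M => by
  have : EssentiallySmall.{u} (FPMod A) := inferInstance
  have := hasColimitsOfShape_of_essentiallySmall.{u} (CostructuredArrow (isFinPres A).ι M)
    AddCommGrpCat.{u}
  unfold Functor.HasPointwiseLeftKanExtensionAt
  infer_instance

/-- The extension of a functor `F : mod-A ⥤ Ab` to a functor `Mod-A ⥤ Ab` that commutes with
direct limits: the left Kan extension along `mod-A ⥤ Mod-A`. Its value at `M` is the direct limit
of the groups `F(X)` over all `X ⟶ M` with `X` in `mod-A`. -/
noncomputable def extend {A : Type u} [Ring A] (F : FPMod A ⥤ AddCommGrpCat.{u}) :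
    RMod A ⥤ AddCommGrpCat.{u} :=
  (isFinPres A).ι.leftKanExtension F

/-- The modules at which the extensions of all functors in `S` vanish. -/
def kerClass {A : Type u} [Ring A] (S : ObjectProperty (FPFun A)) : ObjectProperty (RMod A) :=
  fun M => ∀ F : FPFun A, S F → IsZero ((extend F.obj).obj M)

/-! ### Adelman's category of three-term chains up to homotopy -/

/-- A three-term chain `X₁ ⟶ X₂ ⟶ X₃` (not necessarily a complex). -/
structure Chain (C : Type u) [Category.{v} C] where
  X₁ : C
  X₂ : C
  X₃ : C
  f₁ : X₁ ⟶ X₂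
  f₂ : X₂ ⟶ X₃

namespace Chain

/-- A morphism of three-term chains. -/
@[ext]
structure Hom {C : Type u} [Category.{v} C] (X Y : Chain C) where
  α₁ : X.X₁ ⟶ Y.X₁
  α₂ : X.X₂ ⟶ Y.X₂
  α₃ : X.X₃ ⟶ Y.X₃
  comm₁ : α₁ ≫ Y.f₁ = X.f₁ ≫ α₂
  comm₂ : α₂ ≫ Y.f₂ = X.f₂ ≫ α₃

attribute [simp] Hom.comm₁ Hom.comm₂

instance {C : Type u} [Category.{v} C] : Category (Chain C) where
  Hom := Hom
  id X := ⟨𝟙 _, 𝟙 _, 𝟙 _, by simp, by simp⟩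
  comp {X Y Z} a b := ⟨a.α₁ ≫ b.α₁, a.α₂ ≫ b.α₂, a.α₃ ≫ b.α₃,
    by rw [Category.assoc, b.comm₁, ← Category.assoc, a.comm₁, Category.assoc],
    by rw [Category.assoc, b.comm₂, ← Category.assoc, a.comm₂, Category.assoc]⟩
  id_comp a := Hom.ext (Category.id_comp _) (Category.id_comp _) (Category.id_comp _)
  comp_id a := Hom.ext (Category.comp_id _) (Category.comp_id _) (Category.comp_id _)
  assoc a b c := Hom.ext (Category.assoc _ _ _) (Category.assoc _ _ _) (Category.assoc _ _ _)

theorem comp_α₂ {C : Type u} [Category.{v} C] {X Y Z : Chain C} (α : X ⟶ Y) (β : Y ⟶ Z) :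
    (α ≫ β).α₂ = α.α₂ ≫ β.α₂ := rfl

section Preadditive

variable {C : Type u} [Category.{v} C] [Preadditive C]

instance (X Y : Chain C) : Zero (X ⟶ Y) := ⟨⟨0, 0, 0, by simp, by simp⟩⟩

instance (X Y : Chain C) : Add (X ⟶ Y) :=
  ⟨fun a b => ⟨a.α₁ + b.α₁, a.α₂ + b.α₂, a.α₃ + b.α₃, by simp, by simp⟩⟩

instance (X Y : Chain C) : Neg (X ⟶ Y) :=
  ⟨fun a => ⟨-a.α₁, -a.α₂, -a.α₃, by simp, by simp⟩⟩

instance (X Y : Chain C) : AddCommGroup (X ⟶ Y) where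
  add_assoc a b c := Hom.ext (add_assoc _ _ _) (add_assoc _ _ _) (add_assoc _ _ _)
  zero_add a := Hom.ext (zero_add _) (zero_add _) (zero_add _)
  add_zero a := Hom.ext (add_zero _) (add_zero _) (add_zero _)
  add_comm a b := Hom.ext (add_comm _ _) (add_comm _ _) (add_comm _ _)
  neg_add_cancel a := Hom.ext (neg_add_cancel _) (neg_add_cancel _) (neg_add_cancel _)
  nsmul := nsmulRec
  zsmul := zsmulRec

instance : Preadditive (Chain C) where
  add_comp _ _ _ _ _ _ := Hom.ext (Preadditive.add_comp _ _ _ _ _ _)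
    (Preadditive.add_comp _ _ _ _ _ _) (Preadditive.add_comp _ _ _ _ _ _)
  comp_add _ _ _ _ _ _ := Hom.ext (Preadditive.comp_add _ _ _ _ _ _)
    (Preadditive.comp_add _ _ _ _ _ _) (Preadditive.comp_add _ _ _ _ _ _)

/-- `α` is null-homotopic if its middle component is `g₁ s + t f₂` for some `s`, `t`. -/
def NullHomotopic {X Y : Chain C} (α : X ⟶ Y) : Prop :=
  ∃ (s : X.X₂ ⟶ Y.X₁) (t : X.X₃ ⟶ Y.X₂), α.α₂ = s ≫ Y.f₁ + X.f₂ ≫ t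

variable (C) in
/-- Two parallel morphisms of chains are homotopic if their difference is null-homotopic. -/
def homotopic : HomRel (Chain C) := fun _ _ α β => NullHomotopic (α + -β)

theorem add_α₂ {X Y : Chain C} (α β : X ⟶ Y) : (α + β).α₂ = α.α₂ + β.α₂ := rfl

theorem neg_α₂ {X Y : Chain C} (α : X ⟶ Y) : (-α).α₂ = -α.α₂ := rfl

theorem homotopic_iff {X Y : Chain C} (α β : X ⟶ Y) :
    homotopic C α β ↔
      ∃ (s : X.X₂ ⟶ Y.X₁) (t : X.X₃ ⟶ Y.X₂), α.α₂ - β.α₂ = s ≫ Y.f₁ + X.f₂ ≫ t := by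
  simp only [homotopic, NullHomotopic, add_α₂, neg_α₂, sub_eq_add_neg]

instance : Congruence (homotopic C) where
  comp_left {X Y Z} f g g' h := by
    rw [homotopic_iff] at h ⊢
    obtain ⟨s, t, h⟩ := h
    refine ⟨f.α₂ ≫ s, f.α₃ ≫ t, ?_⟩
    rw [comp_α₂, comp_α₂, ← Preadditive.comp_sub, h, Preadditive.comp_add, Category.assoc,
      ← Category.assoc, ← Category.assoc, ← Category.assoc, f.comm₂]
  comp_right {X Y Z} f f' g h := by
    rw [homotopic_iff] at h ⊢
    obtain ⟨s, t, h⟩ := h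
    refine ⟨s ≫ g.α₁, t ≫ g.α₂, ?_⟩
    rw [comp_α₂, comp_α₂, ← Preadditive.sub_comp, h, Preadditive.add_comp, Category.assoc,
      Category.assoc, Category.assoc, g.comm₁]
  equivalence {X Y} :=
    { refl := fun a => (homotopic_iff a a).2 ⟨0, 0, by simp⟩
      symm := fun {a b} h => by
        rw [homotopic_iff] at h ⊢
        obtain ⟨s, t, h⟩ := h
        refine ⟨-s, -t, ?_⟩
        rw [← neg_sub, h]
        simp only [Preadditive.neg_comp, Preadditive.comp_neg]
        abel
      trans := fun {a b c} h h' => by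
        rw [homotopic_iff] at h h' ⊢
        obtain ⟨s, t, h⟩ := h
        obtain ⟨s', t', h'⟩ := h'
        refine ⟨s + s', t + t', ?_⟩
        rw [← sub_add_sub_cancel _ b.α₂, h, h']
        simp only [Preadditive.add_comp, Preadditive.comp_add]
        abel }

theorem homotopic_add ⦃X Y : Chain C⦄ (f₁ f₂ g₁ g₂ : X ⟶ Y) (h : homotopic C f₁ f₂)
    (h' : homotopic C g₁ g₂) : homotopic C (f₁ + g₁) (f₂ + g₂) := by
  rw [homotopic_iff] at h h' ⊢
  obtain ⟨s, t, h⟩ := h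
  obtain ⟨s', t', h'⟩ := h'
  refine ⟨s + s', t + t', ?_⟩
  rw [add_α₂, add_α₂, add_sub_add_comm, h, h']
  simp only [Preadditive.add_comp, Preadditive.comp_add]
  abel

end Preadditive

end Chain

/-- Adelman's category over `C`: three-term chains over `C` and
morphisms of chains modulo null-homotopic ones. -/
abbrev Adelman (C : Type u) [Category.{v} C] [Preadditive C] : Type (max u v) :=
  CategoryTheory.Quotient (Chain.homotopic C)

instance {C : Type u} [Category.{v} C] [Preadditive C] : Preadditive (Adelman C) :=
  CategoryTheory.Quotient.preadditive (Chain.homotopic C) Chain.homotopic_add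

/-- The right `A`-module `A^n`. -/
abbrev freeModule (A : Type u) [Ring A] (n : ℕ) : RMod A := ModuleCat.of Aᵐᵒᵖ (Fin n → A)

/-- The full subcategory `𝔸` of `mod-A` with objects `0, A, A², A³, …`. -/
abbrev FreeMod (A : Type u) [Ring A] : Type := InducedCategory (RMod A) (freeModule A)

/-- For `𝐀 = (A^n ⟶ A^m ⟶ A^p)` with maps `u`, `v`, the class `Ω_𝐀` of all right modules `M` such
that every `α : A^m ⟶ M` with `α u = 0` is of the form `β v` for some `β : A^p ⟶ M`. -/
def Omega {A : Type u} [Ring A] (T : Adelman (FreeMod A)) : ObjectProperty (RMod A) :=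
  fun M => ∀ α : freeModule A T.as.X₂ ⟶ M, T.as.f₁.hom ≫ α = 0 →
    ∃ β : freeModule A T.as.X₃ ⟶ M, α = T.as.f₂.hom ≫ β

/-- The intersection of the classes `Ω_𝐀` for `𝐀` in `S`. -/
def omegaClass {A : Type u} [Ring A] (S : ObjectProperty (Adelman (FreeMod A))) :
    ObjectProperty (RMod A) :=
  fun M => ∀ T : Adelman (FreeMod A), S T → Omega T M

end FreeAb

universe w

namespace FreeAb

/-! ### Finitely presented modules -/

section FinPres

variable {A : Type u} [Ring A]

/-! Every finitely presented functor is `Coker Hom(f, -)` for a map `f : X ⟶ Y` in `mod-A`, and its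
extension vanishes at `M` exactly when every map `X ⟶ M` extends along `f`
(`vanishes_cokerFun_iff`). So both kinds of classes of modules are injectivity classes for maps
between finitely presented modules. A chain with maps `u`, `v` yields the map `Coker u ⟶ Coker (v
u)`; this induces an equivalence of Adelman's category with the opposite of `mod-(mod-A)` under
which `Ω` becomes injectivity along that map (`omega_iff_injectiveAlong`). Thus (2) follows from
(1).

For (1), `kerClass` and `annihilator` form an antitone Galois connection, and two closure statements
remain.

Serre side (`IsSerre.exists_module`): if `Coker Hom(g, -)` is not in `S`, with `g : X₀ ⟶ Y₀`, a
small object argument starts from the identity of `X₀` and makes all maps with cokernel functor in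
`S` extendable. The invariant is `IsSmallFor`: the composite `x` from `X₀` factors only through maps
of `mod-A` whose cokernel functor is in `S`. It survives pushouts because the maps with cokernel
functor in `S` are closed under left cancellation (quotients), cobase change (subobjects) and
composition (extensions), and it survives direct limits by finite presentation. In the limit, `x`
does not factor through `g`.

Definable side (`IsDefinable.prop_of_injectiveAlong`): if `M` is injective along every map along
which all of `D` is, then `M` embeds purely in a reduced product of members of `D`. Otherwise, some
finite system unsolvable in `M` would be solvable throughout `D` given finitely many relations of
`M`, which is injectivity along a map of `mod-A` and so passes to `M`. -/

instance (X : FPMod A) : Module.FinitePresentation Aᵐᵒᵖ X.obj := X.property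

/-- The object of `mod-A` given by a finitely presented module. -/
abbrev FPMod.of (M : Type u) [AddCommGroup M] [Module Aᵐᵒᵖ M] [Module.FinitePresentation Aᵐᵒᵖ M] :
    FPMod A :=
  ⟨ModuleCat.of Aᵐᵒᵖ M, ‹_›⟩

theorem finitePresentation_quotient_range {M N : Type u} [AddCommGroup M] [Module Aᵐᵒᵖ M]
    [Module.FinitePresentation Aᵐᵒᵖ M] [AddCommGroup N] [Module Aᵐᵒᵖ N] [Module.Finite Aᵐᵒᵖ N]
    (f : N →ₗ[Aᵐᵒᵖ] M) : Module.FinitePresentation Aᵐᵒᵖ (M ⧸ LinearMap.range f) := by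
  refine Module.finitePresentation_of_surjective (LinearMap.range f).mkQ
    (Submodule.mkQ_surjective _) ?_
  rw [Submodule.ker_mkQ]
  exact Module.Finite.iff_fg.1 (Module.Finite.range f)

/-- Weak pushouts in `mod-A`, which remain weak pushouts in `Mod-A`. -/
theorem exists_weakPushout {X N Y : FPMod A} (a : X ⟶ N) (f : X ⟶ Y) :
    ∃ (P : FPMod A) (i : N ⟶ P) (j : Y ⟶ P), a ≫ i = f ≫ j ∧
      ∀ (M : RMod A) (n : N.obj ⟶ M) (y : Y.obj ⟶ M), a.hom ≫ n = f.hom ≫ y →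
        ∃ h : P.obj ⟶ M, i.hom ≫ h = n ∧ j.hom ≫ h = y := by
  let r : X.obj →ₗ[Aᵐᵒᵖ] N.obj × Y.obj := LinearMap.prod a.hom.hom (-f.hom.hom)
  have := finitePresentation_quotient_range r
  let P : FPMod A := FPMod.of ((N.obj × Y.obj) ⧸ LinearMap.range r)
  refine ⟨P, ObjectProperty.homMk (ModuleCat.ofHom ((LinearMap.range r).mkQ ∘ₗ LinearMap.inl _ _ _)),
    ObjectProperty.homMk (ModuleCat.ofHom ((LinearMap.range r).mkQ ∘ₗ LinearMap.inr _ _ _)), ?_, ?_⟩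
  · ext x
    change (LinearMap.range r).mkQ (a.hom x, 0) = (LinearMap.range r).mkQ (0, f.hom x)
    rw [← sub_eq_zero, ← map_sub, Submodule.mkQ_apply, Submodule.Quotient.mk_eq_zero]
    exact ⟨x, by simp [r]⟩
  · intro M n y h
    refine ⟨ModuleCat.ofHom ((LinearMap.range r).liftQ (LinearMap.coprod n.hom y.hom) ?_), ?_, ?_⟩
    · rintro _ ⟨x, rfl⟩
      have := ConcreteCategory.congr_hom h x
      simp only [ModuleCat.hom_comp, LinearMap.comp_apply] at this
      simp [r, this]
    · ext x
      change LinearMap.coprod n.hom y.hom (x, 0) = n.hom x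
      simp
    · ext x
      change LinearMap.coprod n.hom y.hom (0, x) = y.hom x
      simp

/-- Coequalizers in `mod-A` of maps which become equal in a given module. -/
theorem exists_weakCoequalizer {X Y : FPMod A} (f g : X ⟶ Y) :
    ∃ (P : FPMod A) (q : Y ⟶ P), f ≫ q = g ≫ q ∧
      ∀ (M : RMod A) (y : Y.obj ⟶ M), f.hom ≫ y = g.hom ≫ y → ∃ h : P.obj ⟶ M, q.hom ≫ h = y := by
  let r : X.obj →ₗ[Aᵐᵒᵖ] Y.obj := f.hom.hom - g.hom.hom
  have := finitePresentation_quotient_range r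
  let P : FPMod A := FPMod.of (Y.obj ⧸ LinearMap.range r)
  refine ⟨P, ObjectProperty.homMk (ModuleCat.ofHom (LinearMap.range r).mkQ), ?_, ?_⟩
  · ext x
    change (LinearMap.range r).mkQ (f.hom x) = (LinearMap.range r).mkQ (g.hom x)
    rw [← sub_eq_zero, ← map_sub, Submodule.mkQ_apply, Submodule.Quotient.mk_eq_zero]
    exact ⟨x, by simp [r]⟩
  · intro M y h
    refine ⟨ModuleCat.ofHom ((LinearMap.range r).liftQ y.hom ?_), ?_⟩
    · rintro _ ⟨x, rfl⟩
      have := ConcreteCategory.congr_hom h x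
      simp only [ModuleCat.hom_comp, LinearMap.comp_apply] at this
      simp [r, this]
    · ext x
      rfl

/-- Filteredness makes the pointwise Kan extension at `M` a direct limit, so that its vanishing can
be tested on elements. -/
instance isFiltered_costructuredArrow (M : RMod A) :
    IsFiltered (CostructuredArrow (isFinPres A).ι M) where
  cocone_objs p q := by
    -- The pushout of two zero maps is the direct sum.
    obtain ⟨P, i, j, -, h⟩ := exists_weakPushout (0 : p.left ⟶ p.left) (0 : p.left ⟶ q.left)
    obtain ⟨k, hi, hj⟩ := h M p.hom q.hom (by simp)
    exact ⟨CostructuredArrow.mk (Y := P) k, CostructuredArrow.homMk i hi,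
      CostructuredArrow.homMk j hj, trivial⟩
  cocone_maps p q f g := by
    obtain ⟨P, c, hc, h⟩ := exists_weakCoequalizer f.left g.left
    obtain ⟨k, hk⟩ := h M q.hom ((CostructuredArrow.w f).trans (CostructuredArrow.w g).symm)
    exact ⟨CostructuredArrow.mk (Y := P) k, CostructuredArrow.homMk c hk, by ext1; exact hc⟩
  nonempty := ⟨CostructuredArrow.mk (Y := (FPMod.of PUnit : FPMod A)) 0⟩

/-- `F⃗(M) = 0`, expressed by elements: every element of `F(N)`, where `N ⟶ M` with `N` finitely
presented, vanishes in `F(N')` for some factorization `N ⟶ N' ⟶ M`. -/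
def Vanishes (F : FPMod A ⥤ AddCommGrpCat.{u}) (M : RMod A) : Prop :=
  ∀ (N : FPMod A) (n : N.obj ⟶ M) (x : F.obj N),
    ∃ (N' : FPMod A) (c : N ⟶ N') (n' : N'.obj ⟶ M), c.hom ≫ n' = n ∧ F.map c x = 0

/-- In a filtered colimit of groups, an element is zero if and only if it becomes zero at a later
stage. -/
theorem isZero_extend_iff (F : FPMod A ⥤ AddCommGrpCat.{u}) (M : RMod A) :
    IsZero ((extend F).obj M) ↔ Vanishes F M := by
  have : EssentiallySmall.{u} (FPMod A) := inferInstance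
  have : EssentiallySmall.{u} (CostructuredArrow (isFinPres A).ι M) := inferInstance
  -- The index category has objects in `Type (u + 1)`; an equivalent small category shows that the
  -- forgetful functor preserves these colimits.
  let e := equivSmallModel.{u} (CostructuredArrow (isFinPres A).ι M)
  have : IsFiltered (SmallModel.{u} (CostructuredArrow (isFinPres A).ι M)) :=
    IsFiltered.of_equivalence e
  have : PreservesColimitsOfShape (CostructuredArrow (isFinPres A).ι M)
      (forget AddCommGrpCat.{u}) := preservesColimitsOfShape_of_equiv e.symm _
  have hc := (isFinPres A).ι.isPointwiseLeftKanExtensionLeftKanExtensionUnit F M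
  constructor
  · intro h N n x
    have := hc.eq_iff' (i := CostructuredArrow.mk (Y := N) n) x 0
    obtain ⟨j, f, hf⟩ := this.1 (by
      have : Subsingleton ((extend F).obj M) := AddCommGrpCat.subsingleton_of_isZero h
      exact Subsingleton.elim (α := (extend F).obj M) _ _)
    exact ⟨j.left, f.left, j.hom, CostructuredArrow.w f, hf.trans (map_zero _)⟩
  · intro h
    have : Subsingleton ((extend F).obj M) := by
      refine subsingleton_of_forall_eq 0 fun y => ?_
      obtain ⟨j, x, rfl⟩ := Concrete.isColimit_exists_rep _ hc y
      obtain ⟨N', c, n', hn, hx⟩ := h j.left j.hom x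
      have := (hc.eq_iff' (i := j) x 0).2
        ⟨CostructuredArrow.mk (Y := N') n', CostructuredArrow.homMk c hn, by
          exact hx.trans (map_zero _).symm⟩
      exact this.trans (map_zero _)
    exact AddCommGrpCat.isZero_of_subsingleton _

end FinPres

/-! ### Cokernels of maps between representable functors -/

section Coker

variable {A : Type u} [Ring A]

theorem nat_apply {F G : FPMod A ⥤ AddCommGrpCat.{u}} (α : F ⟶ G) {Z Z' : FPMod A} (h : Z ⟶ Z')
    (x : F.obj Z) : α.app Z' (F.map h x) = G.map h (α.app Z x) :=
  ConcreteCategory.congr_hom (α.naturality h) x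

/-- The maps of the form `f ≫ t`. -/
def precompRange {X Y : FPMod A} (f : X ⟶ Y) (Z : FPMod A) : AddSubgroup (X ⟶ Z) :=
  (Preadditive.leftComp Z f).range

/-- The cokernel of `Hom(f, -) : Hom(Y, -) ⟶ Hom(X, -)`. -/
def cokerFun {X Y : FPMod A} (f : X ⟶ Y) : FPMod A ⥤ AddCommGrpCat.{u} where
  obj Z := AddCommGrpCat.of ((X ⟶ Z) ⧸ precompRange f Z)
  map {Z Z'} h := AddCommGrpCat.ofHom (QuotientAddGroup.map _ _ (Preadditive.rightComp X h) (by
    rintro _ ⟨t, rfl⟩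
    exact ⟨t ≫ h, by simp [Preadditive.leftComp, Preadditive.rightComp]⟩))
  map_id Z := by
    ext a
    change QuotientAddGroup.mk (a ≫ 𝟙 Z) = QuotientAddGroup.mk a
    rw [Category.comp_id]
  map_comp {Z Z' Z''} h h' := by
    ext a
    change QuotientAddGroup.mk (a ≫ h ≫ h') = QuotientAddGroup.mk ((a ≫ h) ≫ h')
    rw [Category.assoc]

/-- The projection `Hom(X, Z) ⟶ Coker Hom(f, Z)`. -/
def cokerMk {X Y : FPMod A} (f : X ⟶ Y) (Z : FPMod A) : (X ⟶ Z) →+ (cokerFun f).obj Z :=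
  QuotientAddGroup.mk' (precompRange f Z)

theorem cokerMk_surjective {X Y : FPMod A} (f : X ⟶ Y) (Z : FPMod A) :
    Function.Surjective (cokerMk f Z) :=
  QuotientAddGroup.mk_surjective

theorem cokerMk_eq_zero_iff {X Y : FPMod A} (f : X ⟶ Y) {Z : FPMod A} (a : X ⟶ Z) :
    cokerMk f Z a = 0 ↔ ∃ t : Y ⟶ Z, f ≫ t = a :=
  QuotientAddGroup.eq_zero_iff a

theorem cokerFun_map_mk {X Y : FPMod A} (f : X ⟶ Y) {Z Z' : FPMod A} (h : Z ⟶ Z') (a : X ⟶ Z) :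
    (cokerFun f).map h (cokerMk f Z a) = cokerMk f Z' (a ≫ h) := rfl

/-- Maps out of `Coker Hom(f, -)`. -/
def cokerDesc {X Y : FPMod A} (f : X ⟶ Y) {F : FPMod A ⥤ AddCommGrpCat.{u}}
    (π : ∀ Z, (X ⟶ Z) →+ F.obj Z)
    (hπ : ∀ {Z Z' : FPMod A} (h : Z ⟶ Z') (a : X ⟶ Z), π Z' (a ≫ h) = F.map h (π Z a))
    (h : π Y f = 0) : cokerFun f ⟶ F where
  app Z := AddCommGrpCat.ofHom (QuotientAddGroup.lift (precompRange f Z) (π Z) (by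
    rintro _ ⟨t, rfl⟩
    exact (hπ t f).trans (by rw [h, map_zero])))
  naturality Z Z' t := by
    ext x
    obtain ⟨a, rfl⟩ := cokerMk_surjective f Z x
    exact hπ t a

/-- `Coker Hom(f, -)` as an object of `mod-(mod-A)`. -/
abbrev fpCoker {X Y : FPMod A} (f : X ⟶ Y) : FPFun A :=
  ⟨cokerFun f, X, Y, preadditiveCoyoneda.map f.op,
    { app := fun Z => AddCommGrpCat.ofHom (cokerMk f Z), naturality := fun _ _ _ => rfl }, fun Z =>
    ⟨fun a => cokerMk_eq_zero_iff f a, cokerMk_surjective f Z⟩⟩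

/-- The functoriality of `Coker Hom(f, -)` in the arrow `f`. -/
def fpCokerMap {X Y X' Y' : FPMod A} {f : X ⟶ Y} {g : X' ⟶ Y'} (a : X' ⟶ X) (b : Y' ⟶ Y)
    (w : a ≫ f = g ≫ b) : fpCoker f ⟶ fpCoker g :=
  ObjectProperty.homMk (cokerDesc f (fun Z => (cokerMk g Z).comp (Preadditive.leftComp Z a))
    (fun h x => (congrArg (cokerMk g _) (Category.assoc a x h)).symm)
    ((cokerMk_eq_zero_iff g _).2 ⟨b, w.symm⟩))

theorem fpCokerMap_mk {X Y X' Y' : FPMod A} {f : X ⟶ Y} {g : X' ⟶ Y'} (a : X' ⟶ X) (b : Y' ⟶ Y)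
    (w : a ≫ f = g ≫ b) {Z : FPMod A} (x : X ⟶ Z) :
    (fpCokerMap a b w).hom.app Z (cokerMk f Z x) = cokerMk g Z (a ≫ x) := rfl

/-- Yoneda: the class of `𝟙 X` generates `Coker Hom(f, -)`. -/
theorem fpCoker_hom_ext {X Y : FPMod A} {f : X ⟶ Y} {F : FPFun A} {α β : fpCoker f ⟶ F}
    (h : α.hom.app X (cokerMk f X (𝟙 X)) = β.hom.app X (cokerMk f X (𝟙 X))) :
    α = β := by
  ext Z x
  obtain ⟨a, rfl⟩ := cokerMk_surjective f Z x
  have e : cokerMk f Z a = (cokerFun f).map a (cokerMk f X (𝟙 X)) := by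
    rw [cokerFun_map_mk, Category.id_comp]
  rw [e, nat_apply, nat_apply, h]

/-- The contravariant functor which sends an arrow `f` to `Coker Hom(f, -)`. -/
def fpCokerFunctor (A : Type u) [Ring A] : Arrow (FPMod A) ⥤ (FPFun A)ᵒᵖ where
  obj f := Opposite.op (fpCoker f.hom)
  map {f g} s := (fpCokerMap s.left s.right s.w).op
  map_id f := by
    refine Quiver.Hom.unop_inj (fpCoker_hom_ext ?_)
    change cokerMk _ _ (𝟙 f.left ≫ _) = cokerMk _ _ _
    rw [Category.id_comp]
  map_comp {f g h} s t := by
    refine Quiver.Hom.unop_inj (fpCoker_hom_ext ?_)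
    change cokerMk _ _ ((s.left ≫ t.left) ≫ _) = cokerMk _ _ (s.left ≫ t.left ≫ _)
    rw [Category.assoc]

/-- Lifting the image of the generator gives `a`; since the generator dies under `f`, so does the
class of `a ≫ f`, which gives `b`. -/
theorem exists_fpCokerMap_eq {X Y X' Y' : FPMod A} {f : X ⟶ Y} {g : X' ⟶ Y'}
    (α : fpCoker f ⟶ fpCoker g) :
    ∃ (a : X' ⟶ X) (b : Y' ⟶ Y) (w : a ≫ f = g ≫ b), α = fpCokerMap a b w := by
  obtain ⟨a, ha⟩ := cokerMk_surjective g X (α.hom.app X (cokerMk f X (𝟙 X)))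
  have h' : cokerMk g Y (a ≫ f) = 0 := by
    rw [← cokerFun_map_mk, ha, ← nat_apply, cokerFun_map_mk,
      (cokerMk_eq_zero_iff f _).2 ⟨𝟙 Y, by simp⟩, map_zero]
  obtain ⟨b, hb⟩ := (cokerMk_eq_zero_iff g _).1 h'
  refine ⟨a, b, hb.symm, fpCoker_hom_ext ?_⟩
  rw [← ha, fpCokerMap_mk, Category.comp_id]

theorem fpCokerMap_eq_iff {X Y X' Y' : FPMod A} {f : X ⟶ Y} {g : X' ⟶ Y'}
    {a a' : X' ⟶ X} {b b' : Y' ⟶ Y} (w : a ≫ f = g ≫ b) (w' : a' ≫ f = g ≫ b') :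
    fpCokerMap a b w = fpCokerMap a' b' w' ↔ ∃ t : Y' ⟶ X, g ≫ t = a - a' := by
  rw [← cokerMk_eq_zero_iff, map_sub, sub_eq_zero]
  constructor
  · intro h
    have : cokerMk g X (a ≫ 𝟙 X) = cokerMk g X (a' ≫ 𝟙 X) :=
      congrArg (fun α => α.hom.app X (cokerMk f X (𝟙 X))) h
    rwa [Category.comp_id, Category.comp_id] at this
  · intro h
    refine fpCoker_hom_ext ?_
    rw [fpCokerMap_mk, fpCokerMap_mk, Category.comp_id, Category.comp_id, h]

theorem exists_presentation (F : FPFun A) :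
    ∃ (X Y : FPMod A) (f : X ⟶ Y) (π : ∀ Z, (X ⟶ Z) →+ F.obj.obj Z),
      (∀ {Z Z' : FPMod A} (h : Z ⟶ Z') (a : X ⟶ Z), π Z' (a ≫ h) = F.obj.map h (π Z a)) ∧
      (∀ Z, Function.Surjective (π Z)) ∧
      ∀ (Z) (a : X ⟶ Z), π Z a = 0 ↔ ∃ t : Y ⟶ Z, f ≫ t = a := by
  obtain ⟨X, Y, φ, π, h⟩ := F.property
  -- By Yoneda, `φ` is precomposition with this map.
  let f : X ⟶ Y := φ.app Y (𝟙 Y)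
  have hφ {Z : FPMod A} (t : Y ⟶ Z) : φ.app Z t = f ≫ t := by
    have := ConcreteCategory.congr_hom (φ.naturality t) (𝟙 Y)
    refine Eq.trans ?_ this
    change _ = φ.app Z (𝟙 Y ≫ t)
    rw [Category.id_comp]
  refine ⟨X, Y, f, fun Z => (π.app Z).hom, fun h a => ConcreteCategory.congr_hom (π.naturality h) a,
    fun Z => (h Z).2, fun Z a => ((h Z).1 a).trans ⟨?_, ?_⟩⟩
  · rintro ⟨t, ht⟩
    exact ⟨t, (hφ t).symm.trans ht⟩
  · rintro ⟨t, ht⟩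
    exact ⟨t, (hφ t).trans ht⟩

theorem exists_iso_fpCoker (F : FPFun A) :
    ∃ (X Y : FPMod A) (f : X ⟶ Y), Nonempty (fpCoker f ≅ F) := by
  obtain ⟨X, Y, f, π, hnat, hs, h⟩ := exists_presentation F
  refine ⟨X, Y, f, ?_⟩
  let α : cokerFun f ⟶ F.obj := cokerDesc f π hnat ((h _ f).2 ⟨𝟙 Y, Category.comp_id f⟩)
  have (Z : FPMod A) : IsIso (α.app Z) := by
    rw [ConcreteCategory.isIso_iff_bijective]
    constructor
    · rw [injective_iff_map_eq_zero]
      intro x hx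
      obtain ⟨a, rfl⟩ := cokerMk_surjective f Z x
      exact (cokerMk_eq_zero_iff f a).2 ((h Z a).1 hx)
    · intro y
      obtain ⟨a, rfl⟩ := hs Z y
      exact ⟨cokerMk f Z a, rfl⟩
  have : IsIso α := NatIso.isIso_of_isIso_app α
  exact ⟨ObjectProperty.isoMk _ (asIso α)⟩

/-- `M` is injective with respect to `f`: every map `X ⟶ M` extends along `f : X ⟶ Y`. -/
def InjectiveAlong {X Y : FPMod A} (f : X ⟶ Y) (M : RMod A) : Prop :=
  ∀ x : X.obj ⟶ M, ∃ y : Y.obj ⟶ M, f.hom ≫ y = x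

/-- Forwards, the vanishing of the generic element `𝟙 X` at a later stage is an extension along `f`.
Backwards, an element `a : X ⟶ N` is killed by passing to the pushout of `f` along `a`, which still
maps to `M`. -/
theorem vanishes_cokerFun_iff {X Y : FPMod A} (f : X ⟶ Y) (M : RMod A) :
    Vanishes (cokerFun f) M ↔ InjectiveAlong f M := by
  constructor
  · intro h x
    obtain ⟨N, c, n, rfl, hc⟩ := h X x (cokerMk f X (𝟙 X))
    rw [cokerFun_map_mk, Category.id_comp, cokerMk_eq_zero_iff] at hc
    obtain ⟨t, rfl⟩ := hc
    exact ⟨t.hom ≫ n, by simp⟩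
  · intro h N n x
    obtain ⟨a, rfl⟩ := cokerMk_surjective f N x
    obtain ⟨y, hy⟩ := h (a.hom ≫ n)
    obtain ⟨P, i, j, hij, hP⟩ := exists_weakPushout a f
    obtain ⟨p, rfl, -⟩ := hP M n y hy.symm
    refine ⟨P, i, p, rfl, ?_⟩
    rw [cokerFun_map_mk, cokerMk_eq_zero_iff]
    exact ⟨j, hij.symm⟩

theorem Vanishes.of_injective {F G : FPMod A ⥤ AddCommGrpCat.{u}} (α : F ⟶ G)
    (hα : ∀ Z, Function.Injective (α.app Z)) {M : RMod A} (h : Vanishes G M) : Vanishes F M := by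
  intro N n x
  obtain ⟨N', c, n', hc, h0⟩ := h N n (α.app N x)
  refine ⟨N', c, n', hc, hα N' ?_⟩
  rw [nat_apply, h0, map_zero]

theorem Vanishes.of_surjective {F G : FPMod A ⥤ AddCommGrpCat.{u}} (α : F ⟶ G)
    (hα : ∀ Z, Function.Surjective (α.app Z)) {M : RMod A} (h : Vanishes F M) : Vanishes G M := by
  intro N n y
  obtain ⟨x, rfl⟩ := hα N y
  obtain ⟨N', c, n', hc, h0⟩ := h N n x
  exact ⟨N', c, n', hc, by rw [← nat_apply, h0, map_zero]⟩

theorem Vanishes.of_exact {F G H : FPMod A ⥤ AddCommGrpCat.{u}} (α : F ⟶ G) (β : G ⟶ H)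
    (h : ∀ Z (y : G.obj Z), β.app Z y = 0 → ∃ x : F.obj Z, α.app Z x = y) {M : RMod A}
    (hF : Vanishes F M) (hH : Vanishes H M) : Vanishes G M := by
  intro N n y
  obtain ⟨N', c, n', rfl, h0⟩ := hH N n (β.app N y)
  rw [← nat_apply] at h0
  obtain ⟨x, hx⟩ := h _ _ h0
  obtain ⟨N'', c', n'', rfl, h1⟩ := hF N' n' x
  refine ⟨N'', c ≫ c', n'', by simp, ?_⟩
  rw [Functor.map_comp, ConcreteCategory.comp_apply, ← hx, ← nat_apply, h1, map_zero]

theorem Vanishes.of_iso {F G : FPFun A} (e : F ≅ G) {M : RMod A} (h : Vanishes F.obj M) :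
    Vanishes G.obj M := by
  let e' : F.obj ≅ G.obj := (isFinPresFunctor A).ι.mapIso e
  exact h.of_surjective e'.hom fun Z =>
    (ConcreteCategory.bijective_of_isIso (e'.hom.app Z)).2

end Coker

/-! ### Exactness in `mod-(mod-A)` -/

section Exactness

variable {A : Type u} [Ring A]

theorem FPFun.zero_app {F G : FPFun A} {Z : FPMod A} (x : F.obj.obj Z) :
    (0 : F ⟶ G).hom.app Z x = 0 := rfl

theorem FPFun.comp_app {F G H : FPFun A} (α : F ⟶ G) (β : G ⟶ H) {Z : FPMod A}
    (x : F.obj.obj Z) : (α ≫ β).hom.app Z x = β.hom.app Z (α.hom.app Z x) := rfl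

/-- Elements of `F(N)` are maps `Hom(N, -) ⟶ F`. -/
theorem FPFun.exists_hom {F : FPFun A} {N : FPMod A} (x : F.obj.obj N) :
    ∃ α : fpCoker (0 : N ⟶ N) ⟶ F, α.hom.app N (cokerMk (0 : N ⟶ N) N (𝟙 N)) = x := by
  obtain ⟨X, Y, f, π, hnat, hs, h⟩ := exists_presentation F
  obtain ⟨a, rfl⟩ := hs N x
  refine ⟨ObjectProperty.homMk (cokerDesc (0 : N ⟶ N)
    (fun Z => (π Z).comp (Preadditive.leftComp Z a)) (fun h x => ?_) ?_), ?_⟩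
  · exact (congrArg (π _) (Category.assoc a x h)).symm.trans (hnat h (a ≫ x))
  · exact (congrArg (π N) comp_zero).trans (map_zero _)
  · exact congrArg (π N) (Category.comp_id a)

/-- Since `fpCoker (0 : N ⟶ N)` is `Hom(N, -)`, elements are morphisms, on which a monomorphism can
be cancelled. -/
theorem FPFun.injective_of_mono {F G : FPFun A} (α : F ⟶ G) [Mono α] (Z : FPMod A) :
    Function.Injective (α.hom.app Z) := by
  rw [injective_iff_map_eq_zero]
  intro x hx
  obtain ⟨β, rfl⟩ := FPFun.exists_hom x
  have : β = 0 := by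
    rw [← cancel_mono α, zero_comp]
    exact fpCoker_hom_ext hx
  rw [this, FPFun.zero_app]

/-- The pointwise cokernel of `α` is again finitely presented, namely `Coker Hom(q, -)` with `q =
(g, p)` from `X` to the direct sum of `Y` and `XF`. For an epimorphism, the projection onto it is
zero. -/
theorem FPFun.surjective_of_epi {F G : FPFun A} (α : F ⟶ G) [Epi α] (Z : FPMod A) :
    Function.Surjective (α.hom.app Z) := by
  obtain ⟨XF, YF, f, πF, hFnat, hFs, hF⟩ := exists_presentation F
  obtain ⟨X, Y, g, π, hnat, hs, hG⟩ := exists_presentation G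
  obtain ⟨p, hp⟩ := hs XF (α.hom.app XF (πF XF (𝟙 XF)))
  have hα {Z : FPMod A} (x : XF ⟶ Z) : α.hom.app Z (πF Z x) = π Z (p ≫ x) := by
    have := hFnat x (𝟙 XF)
    rw [Category.id_comp] at this
    rw [this, nat_apply, ← hp, hnat]
  obtain ⟨P, i, j, hij, hP⟩ := exists_weakPushout (0 : X ⟶ Y) (0 : X ⟶ XF)
  let q : X ⟶ P := g ≫ i + p ≫ j
  have hq {Z : FPMod A} (y : Y ⟶ Z) (x : XF ⟶ Z) : ∃ t : P ⟶ Z, q ≫ t = g ≫ y + p ≫ x := by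
    obtain ⟨h, h1, h2⟩ := hP Z.obj y.hom x.hom (by simp)
    refine ⟨ObjectProperty.homMk h, ?_⟩
    have h1' : i ≫ ObjectProperty.homMk h = y := by ext1; exact h1
    have h2' : j ≫ ObjectProperty.homMk h = x := by ext1; exact h2
    rw [Preadditive.add_comp, Category.assoc, Category.assoc, h1', h2']
  have hs' (Z : FPMod A) : Function.Surjective (π Z) := hs Z
  choose σ hσ using hs
  have key {Z : FPMod A} (a a' : X ⟶ Z) (h : π Z a = π Z a') :
      cokerMk q Z a = cokerMk q Z a' := by
    rw [← sub_eq_zero, ← map_sub, cokerMk_eq_zero_iff]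
    rw [← sub_eq_zero, ← map_sub, hG] at h
    obtain ⟨y, hy⟩ := h
    obtain ⟨t, ht⟩ := hq y 0
    exact ⟨t, by rw [ht, hy, comp_zero, add_zero]⟩
  let β : G ⟶ fpCoker q := ObjectProperty.homMk
    { app := fun Z => AddCommGrpCat.ofHom
        { toFun := fun y => cokerMk q Z (σ Z y)
          map_zero' := by
            exact (key _ 0 (by rw [hσ, map_zero])).trans (map_zero (cokerMk q Z))
          map_add' := fun y y' => by
            exact (key _ (σ Z y + σ Z y') (by rw [hσ, map_add, hσ, hσ])).trans
              (map_add (cokerMk q Z) _ _) }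
      naturality := fun Z Z' h => by
        ext y
        refine (key (σ Z' (G.obj.map h y)) (σ Z y ≫ h) ?_).trans (cokerFun_map_mk q h (σ Z y)).symm
        rw [hσ, hnat, hσ] }
  have hβ {Z : FPMod A} (a : X ⟶ Z) : β.hom.app Z (π Z a) = cokerMk q Z a :=
    key _ _ (hσ _ _)
  have h0 : β = 0 := by
    rw [← cancel_epi α, comp_zero]
    ext Z x
    obtain ⟨x, rfl⟩ := hFs Z x
    rw [FPFun.comp_app, hα, hβ, FPFun.zero_app, cokerMk_eq_zero_iff]
    obtain ⟨t, ht⟩ := hq 0 x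
    exact ⟨t, by rw [ht, comp_zero, zero_add]⟩
  intro y
  obtain ⟨a, rfl⟩ := hs' Z y
  have := hβ a
  rw [h0, FPFun.zero_app, eq_comm, cokerMk_eq_zero_iff] at this
  obtain ⟨t, rfl⟩ := this
  refine ⟨πF Z (j ≫ t), ?_⟩
  rw [hα, eq_comm, ← sub_eq_zero, ← map_sub, hG]
  exact ⟨i ≫ t, by simp [q]⟩

theorem FPFun.mono_of_injective {F G : FPFun A} (α : F ⟶ G)
    (h : ∀ Z, Function.Injective (α.hom.app Z)) : Mono α where
  right_cancellation β γ e := by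
    ext Z x
    exact h Z (congrArg (fun δ => δ.hom.app Z x) e)

theorem FPFun.epi_of_surjective {F G : FPFun A} (α : F ⟶ G)
    (h : ∀ Z, Function.Surjective (α.hom.app Z)) : Epi α where
  left_cancellation β γ e := by
    ext Z y
    obtain ⟨x, rfl⟩ := h Z y
    exact congrArg (fun δ => δ.hom.app Z x) e

/-- Exactness supplies a kernel of `S.g` and an epimorphism from `S.X₁` onto it. An element killed
by `S.g` is a map from a representable functor into this kernel, and epimorphisms are pointwise
surjective. -/
theorem FPFun.exact_of_shortExact {S : ShortComplex (FPFun A)} (hS : S.ShortExact) {Z : FPMod A}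
    (y : S.X₂.obj.obj Z) (hy : S.g.hom.app Z y = 0) : ∃ x : S.X₁.obj.obj Z, S.f.hom.app Z x = y := by
  obtain ⟨h, hz⟩ := hS.exact.condition
  have := hS.exact.epi_f' h.left
  obtain ⟨β, rfl⟩ := FPFun.exists_hom y
  let γ : fpCoker (0 : Z ⟶ Z) ⟶ h.left.K := h.left.liftK β (fpCoker_hom_ext hy)
  obtain ⟨x, hx⟩ := FPFun.surjective_of_epi h.left.f' Z (γ.hom.app Z (cokerMk (0 : Z ⟶ Z) Z (𝟙 Z)))
  refine ⟨x, ?_⟩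
  have h1 : h.left.f' ≫ h.left.i = S.f := h.left.f'_i
  have h2 : γ ≫ h.left.i = β := h.left.liftK_i _ _
  rw [← h1, FPFun.comp_app, hx, ← FPFun.comp_app, h2]

/-! ### From pointwise exactness to exactness in the category. -/

theorem FPFun.exists_lift {W F G : FPFun A} (α : F ⟶ G) (hα : ∀ Z, Function.Injective (α.hom.app Z))
    (γ : W ⟶ G) (h : ∀ Z (w : W.obj.obj Z), ∃ x : F.obj.obj Z, α.hom.app Z x = γ.hom.app Z w) :
    ∃ δ : W ⟶ F, δ ≫ α = γ := by
  choose σ hσ using h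
  refine ⟨ObjectProperty.homMk
    { app := fun Z => AddCommGrpCat.ofHom
        { toFun := σ Z
          map_zero' := hα Z (by rw [hσ, map_zero, map_zero])
          map_add' := fun x y => hα Z (by rw [hσ, map_add, map_add, hσ, hσ]) }
      naturality := fun Z Z' t => ?_ }, ?_⟩
  · ext x
    change σ Z' (W.obj.map t x) = F.obj.map t (σ Z x)
    exact hα Z' (by rw [hσ, nat_apply, nat_apply, hσ])
  · ext Z x
    exact hσ Z x

theorem FPFun.exists_desc {G H W : FPFun A} (β : G ⟶ H) (hβ : ∀ Z, Function.Surjective (β.hom.app Z))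
    (γ : G ⟶ W) (h : ∀ Z (y : G.obj.obj Z), β.hom.app Z y = 0 → γ.hom.app Z y = 0) :
    ∃ δ : H ⟶ W, β ≫ δ = γ := by
  choose σ hσ using hβ
  have key {Z : FPMod A} {y y' : G.obj.obj Z} (e : β.hom.app Z y = β.hom.app Z y') :
      γ.hom.app Z y = γ.hom.app Z y' := by
    rw [← sub_eq_zero, ← map_sub] at e ⊢
    exact h Z _ e
  refine ⟨ObjectProperty.homMk
    { app := fun Z => AddCommGrpCat.ofHom
        { toFun := fun x => γ.hom.app Z (σ Z x)
          map_zero' := (key (by rw [hσ, map_zero])).trans (map_zero (γ.hom.app Z).hom)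
          map_add' := fun x y => (key (by rw [hσ, map_add, hσ, hσ])).trans
            (map_add (γ.hom.app Z).hom (σ Z x) (σ Z y)) }
      naturality := fun Z Z' t => ?_ }, ?_⟩
  · ext x
    refine (key (y' := G.obj.map t (σ Z x)) ?_).trans (nat_apply γ.hom t (σ Z x))
    rw [hσ, nat_apply, hσ]
    rfl
  · ext Z x
    exact key (hσ Z _)

theorem FPFun.isZero_fpCoker_id (X : FPMod A) : IsZero (fpCoker (𝟙 X)) := by
  rw [IsZero.iff_id_eq_zero]
  refine fpCoker_hom_ext ?_
  change cokerMk (𝟙 X) X (𝟙 X) = 0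
  rw [cokerMk_eq_zero_iff]
  exact ⟨𝟙 X, by simp⟩

theorem FPFun.shortExact_of_exact (S : ShortComplex (FPFun A))
    (hf : ∀ Z, Function.Injective (S.f.hom.app Z)) (hg : ∀ Z, Function.Surjective (S.g.hom.app Z))
    (h : ∀ Z (y : S.X₂.obj.obj Z), S.g.hom.app Z y = 0 → ∃ x : S.X₁.obj.obj Z, S.f.hom.app Z x = y) :
    S.ShortExact := by
  have : Mono S.f := FPFun.mono_of_injective _ hf
  have : Epi S.g := FPFun.epi_of_surjective _ hg
  let O : FPFun A := fpCoker (𝟙 (FPMod.of PUnit : FPMod A))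
  have hO : IsZero O := FPFun.isZero_fpCoker_id _
  have hl {W : FPFun A} (γ : W ⟶ S.X₂) (e : γ ≫ S.g = 0) : ∃ δ : W ⟶ S.X₁, δ ≫ S.f = γ :=
    FPFun.exists_lift S.f hf γ fun Z w => h Z _ (congrArg (fun δ => δ.hom.app Z w) e)
  have hr {W : FPFun A} (γ : S.X₂ ⟶ W) (e : S.f ≫ γ = 0) : ∃ δ : S.X₃ ⟶ W, S.g ≫ δ = γ := by
    refine FPFun.exists_desc S.g hg γ fun Z y hy => ?_
    obtain ⟨x, rfl⟩ := h Z y hy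
    exact congrArg (fun δ => δ.hom.app Z x) e
  have hi : IsLimit (KernelFork.ofι S.f S.zero) := KernelFork.IsLimit.ofι' _ _ fun γ e =>
    ⟨(hl γ e).choose, (hl γ e).choose_spec⟩
  have hp : IsColimit (CokernelCofork.ofπ S.g S.zero) := CokernelCofork.IsColimit.ofπ' _ _ fun γ e =>
    ⟨(hr γ e).choose, (hr γ e).choose_spec⟩
  -- As `S.f` is itself the kernel of `S.g`, the comparison map from `S.X₁` to it is the identity;
  -- its cokernel, the homology, is zero. The dual holds for `S.g`.
  have h1 : hi.lift (KernelFork.ofι _ S.zero) = 𝟙 S.X₁ := by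
    rw [← cancel_mono S.f]
    exact (hi.fac _ WalkingParallelPair.zero).trans (Category.id_comp _).symm
  have h2 : hp.desc (CokernelCofork.ofπ _ S.zero) = 𝟙 S.X₃ := by
    rw [← cancel_epi S.g]
    exact (hp.fac _ WalkingParallelPair.one).trans (Category.comp_id _).symm
  have : Epi (0 : S.X₁ ⟶ O) := ⟨fun _ _ _ => hO.eq_of_src _ _⟩
  have : Mono (0 : O ⟶ S.X₃) := ⟨fun _ _ _ => hO.eq_of_tgt _ _⟩
  let L : S.LeftHomologyData :=
    { K := S.X₁
      H := O
      i := S.f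
      π := 0
      wi := S.zero
      hi := hi
      wπ := comp_zero
      hπ := CokernelCofork.IsColimit.ofπ' _ _ fun γ e => ⟨0, by
        rw [h1] at e
        exact zero_comp.trans ((Category.id_comp γ).symm.trans e).symm⟩ }
  let R : S.RightHomologyData :=
    { Q := S.X₃
      H := O
      p := S.g
      ι := 0
      wp := S.zero
      hp := hp
      wι := zero_comp
      hι := KernelFork.IsLimit.ofι' _ _ fun γ e => ⟨0, by
        rw [h2] at e
        exact comp_zero.trans ((Category.comp_id γ).symm.trans e).symm⟩ }
  exact { exact := ⟨{ left := L, right := R, iso := Iso.refl O, comm := by simp [L, R, S.zero] }, hO⟩ }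

end Exactness

/-! ### Serre subcategories of `mod-(mod-A)` -/

section SerreFPFun

variable {A : Type u} [Ring A]

/-- The functors whose extensions vanish on `D`. -/
def annihilator (D : ObjectProperty (RMod A)) : ObjectProperty (FPFun A) :=
  fun F => ∀ M, D M → Vanishes F.obj M

theorem isSerre_annihilator (D : ObjectProperty (RMod A)) : IsSerre (annihilator D) where
  containsZero := ⟨fpCoker (𝟙 (FPMod.of PUnit : FPMod A)), FPFun.isZero_fpCoker_id _, fun M _ =>
    (vanishes_cokerFun_iff _ M).2 fun x => ⟨x, Category.id_comp x⟩⟩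
  subobjects := ⟨fun α _ h M hM => (h M hM).of_injective α.hom (FPFun.injective_of_mono α)⟩
  quotients := ⟨fun α _ h M hM => (h M hM).of_surjective α.hom (FPFun.surjective_of_epi α)⟩
  extensions := ⟨fun {S} hS h₁ h₃ M hM => Vanishes.of_exact S.f.hom S.g.hom
    (fun _ y hy => FPFun.exact_of_shortExact hS y hy) (h₁ M hM) (h₃ M hM)⟩

variable {S : ObjectProperty (FPFun A)}

theorem IsSerre.fpCoker_id (hS : IsSerre S) (X : FPMod A) : S (fpCoker (𝟙 X)) := by
  obtain ⟨Z, hZ, h⟩ := hS.containsZero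
  have := hS.subobjects
  exact S.prop_of_iso (hZ.iso (FPFun.isZero_fpCoker_id X)) h

/-- Closure under quotients: a map that factors through `f ≫ p` factors through `f`, so the functor
of `f ≫ p` surjects onto that of `f`. -/
theorem IsSerre.fpCoker_of_comp (hS : IsSerre S) {X Y Z : FPMod A} (f : X ⟶ Y) (p : Y ⟶ Z)
    (h : S (fpCoker (f ≫ p))) : S (fpCoker f) := by
  have := hS.quotients
  let α : fpCoker (f ≫ p) ⟶ fpCoker f := fpCokerMap (𝟙 X) p (Category.id_comp _)
  have : Epi α := FPFun.epi_of_surjective α fun Z y => by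
    obtain ⟨a, rfl⟩ := cokerMk_surjective f Z y
    exact ⟨cokerMk (f ≫ p) Z a, by rw [fpCokerMap_mk, Category.id_comp]⟩
  exact S.prop_of_epi α h

/-- Closure under subobjects: by the pushout property, `n` factors through `i` as soon as `a ≫ n`
factors through `f`. -/
theorem IsSerre.fpCoker_cobaseChange (hS : IsSerre S) {X Y N P : FPMod A} (f : X ⟶ Y) (a : X ⟶ N)
    (i : N ⟶ P) (j : Y ⟶ P) (w : a ≫ i = f ≫ j)
    (hP : ∀ (M : RMod A) (n : N.obj ⟶ M) (y : Y.obj ⟶ M), a.hom ≫ n = f.hom ≫ y →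
        ∃ h : P.obj ⟶ M, i.hom ≫ h = n ∧ j.hom ≫ h = y)
    (h : S (fpCoker f)) : S (fpCoker i) := by
  have := hS.subobjects
  let α : fpCoker i ⟶ fpCoker f := fpCokerMap a j w
  have : Mono α := FPFun.mono_of_injective α fun Z => by
    rw [injective_iff_map_eq_zero]
    intro x hx
    obtain ⟨n, rfl⟩ := cokerMk_surjective i Z x
    rw [fpCokerMap_mk, cokerMk_eq_zero_iff] at hx
    obtain ⟨y, hy⟩ := hx
    rw [cokerMk_eq_zero_iff]
    obtain ⟨t, ht, -⟩ := hP Z.obj n.hom y.hom (congrArg InducedCategory.Hom.hom hy.symm)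
    exact ⟨ObjectProperty.homMk t, by ext1; exact ht⟩
  exact S.prop_of_mono α h

/-- Closure under extensions: the functor of `f ≫ f'` surjects onto that of `f`, and the kernel is
the functor of `i`, the pushout of `f ≫ f'` along `f`. -/
theorem IsSerre.fpCoker_comp (hS : IsSerre S) {X Y Z : FPMod A} (f : X ⟶ Y) (f' : Y ⟶ Z)
    (h : S (fpCoker f)) (h' : S (fpCoker f')) : S (fpCoker (f ≫ f')) := by
  have := hS.extensions
  obtain ⟨P, i, j, w, hP⟩ := exists_weakPushout f (f ≫ f')
  have hi : S (fpCoker i) := by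
    -- The map `f'` factors through `i`, so left cancellation applies.
    obtain ⟨p, hp, -⟩ := hP Z.obj f'.hom (𝟙 _) (Category.comp_id _).symm
    refine hS.fpCoker_of_comp i (ObjectProperty.homMk p) ?_
    have : i ≫ ObjectProperty.homMk p = f' := by ext1; exact hp
    rwa [this]
  let α : fpCoker i ⟶ fpCoker (f ≫ f') := fpCokerMap f j w
  let β : fpCoker (f ≫ f') ⟶ fpCoker f := fpCokerMap (𝟙 X) f' (Category.id_comp _)
  have hαβ : α ≫ β = 0 := by
    refine fpCoker_hom_ext ?_
    rw [FPFun.comp_app, fpCokerMap_mk, fpCokerMap_mk, FPFun.zero_app, cokerMk_eq_zero_iff]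
    exact ⟨𝟙 Y, by simp⟩
  refine S.prop_X₂_of_shortExact (S := ShortComplex.mk α β hαβ)
    (FPFun.shortExact_of_exact _ ?_ ?_ ?_) hi h
  · intro T
    change Function.Injective (α.hom.app T)
    rw [injective_iff_map_eq_zero]
    intro x hx
    obtain ⟨n, rfl⟩ := cokerMk_surjective i T x
    rw [fpCokerMap_mk, cokerMk_eq_zero_iff] at hx
    obtain ⟨y, hy⟩ := hx
    rw [cokerMk_eq_zero_iff]
    obtain ⟨t, ht, -⟩ := hP T.obj n.hom y.hom (congrArg InducedCategory.Hom.hom hy.symm)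
    exact ⟨ObjectProperty.homMk t, by ext1; exact ht⟩
  · intro T y
    obtain ⟨a, rfl⟩ := cokerMk_surjective f T y
    exact ⟨cokerMk (f ≫ f') T a, by
      change β.hom.app T _ = _
      rw [fpCokerMap_mk, Category.id_comp]⟩
  · intro T y hy
    obtain ⟨a, rfl⟩ := cokerMk_surjective (f ≫ f') T y
    change β.hom.app T _ = 0 at hy
    rw [fpCokerMap_mk, Category.id_comp, cokerMk_eq_zero_iff] at hy
    obtain ⟨t, rfl⟩ := hy
    exact ⟨cokerMk i T t, fpCokerMap_mk f j w t⟩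

end SerreFPFun

/-! ### The free modules `A^n` -/

section Free

variable {A : Type u} [Ring A]

/-- The linear map `A^n → M` given by `n` elements of `M`. -/
def freeLift {n : ℕ} {M : Type*} [AddCommGroup M] [Module Aᵐᵒᵖ M] (x : Fin n → M) :
    (Fin n → A) →ₗ[Aᵐᵒᵖ] M where
  toFun c := ∑ i, op (c i) • x i
  map_add' c d := by simp [add_smul, Finset.sum_add_distrib]
  map_smul' r c := by simp [Finset.smul_sum, smul_smul]

theorem freeLift_apply {n : ℕ} {M : Type*} [AddCommGroup M] [Module Aᵐᵒᵖ M] (x : Fin n → M)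
    (c : Fin n → A) : freeLift x c = ∑ i, op (c i) • x i := rfl

theorem freeLift_single {n : ℕ} {M : Type*} [AddCommGroup M] [Module Aᵐᵒᵖ M] (x : Fin n → M)
    (i : Fin n) : freeLift (A := A) x (Pi.single i 1) = x i := by
  rw [freeLift_apply, Finset.sum_eq_single i]
  · simp
  · intro j _ hj
    simp [hj]
  · simp

theorem freeLift_eq {n : ℕ} {M : Type*} [AddCommGroup M] [Module Aᵐᵒᵖ M]
    (h : (Fin n → A) →ₗ[Aᵐᵒᵖ] M) : freeLift (fun i => h (Pi.single i 1)) = h := by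
  refine LinearMap.ext fun c => ?_
  have : c = ∑ i, op (c i) • (Pi.single i 1 : Fin n → A) := by
    ext j
    simp [Finset.sum_apply, Pi.single_apply]
  rw [freeLift_apply]
  conv_rhs => rw [this, map_sum]
  simp only [map_smul]

theorem free_hom_ext {n : ℕ} {M : Type*} [AddCommGroup M] [Module Aᵐᵒᵖ M]
    {h h' : (Fin n → A) →ₗ[Aᵐᵒᵖ] M} (e : ∀ i, h (Pi.single i 1) = h' (Pi.single i 1)) : h = h' := by
  rw [← freeLift_eq h, ← freeLift_eq h', funext e]

theorem exists_lift_of_range_le {n : ℕ} {K M : Type*} [AddCommGroup M] [Module Aᵐᵒᵖ M]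
    [AddCommGroup K] [Module Aᵐᵒᵖ K] (φ : (Fin n → A) →ₗ[Aᵐᵒᵖ] M) (r : K →ₗ[Aᵐᵒᵖ] M)
    (h : ∀ c, φ c ∈ LinearMap.range r) : ∃ s : (Fin n → A) →ₗ[Aᵐᵒᵖ] K, r ∘ₗ s = φ := by
  choose k hk using fun i => h (Pi.single i 1)
  refine ⟨freeLift k, free_hom_ext fun i => ?_⟩
  rw [LinearMap.comp_apply, freeLift_single, hk]

theorem exists_free_surjective (M : Type*) [AddCommGroup M] [Module Aᵐᵒᵖ M]
    [Module.Finite Aᵐᵒᵖ M] : ∃ (n : ℕ) (q : (Fin n → A) →ₗ[Aᵐᵒᵖ] M), Function.Surjective q := by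
  obtain ⟨n, x, hx⟩ := Module.Finite.exists_fin (R := Aᵐᵒᵖ) (M := M)
  refine ⟨n, freeLift x, ?_⟩
  rw [← LinearMap.range_eq_top, eq_top_iff, ← hx, Submodule.span_le]
  rintro _ ⟨i, rfl⟩
  exact ⟨Pi.single i 1, freeLift_single x i⟩

instance (n : ℕ) : Module.FinitePresentation Aᵐᵒᵖ (Fin n → A) :=
  Module.FinitePresentation.of_equiv (M := Fin n → Aᵐᵒᵖ)
    { toFun := fun c i => unop (c i)
      invFun := fun c i => op (c i)
      map_add' := fun _ _ => rfl
      map_smul' := fun r c => by ext i; simp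
      left_inv := fun _ => rfl
      right_inv := fun _ => rfl }

end Free

/-! ### The equivalence of Adelman's category with the opposite of `mod-(mod-A)` -/

section Equivalence

variable {A : Type u} [Ring A]

/-- The first map of a chain of free modules, as a linear map. -/
abbrev Chain.u (T : Chain (FreeMod A)) : freeModule A T.X₁ →ₗ[Aᵐᵒᵖ] freeModule A T.X₂ :=
  T.f₁.hom.hom

/-- The second map of a chain of free modules, as a linear map. -/
abbrev Chain.v (T : Chain (FreeMod A)) : freeModule A T.X₂ →ₗ[Aᵐᵒᵖ] freeModule A T.X₃ :=
  T.f₂.hom.hom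

/-- The cokernel of `u` for a chain `A^n ⟶ A^m ⟶ A^p` with maps `u` and `v`. -/
def chainLeft (T : Chain (FreeMod A)) : FPMod A :=
  have := finitePresentation_quotient_range T.u
  FPMod.of (freeModule A T.X₂ ⧸ LinearMap.range T.u)

/-- The cokernel of `v u` for a chain `A^n ⟶ A^m ⟶ A^p` with maps `u` and `v`. -/
def chainRight (T : Chain (FreeMod A)) : FPMod A :=
  have := finitePresentation_quotient_range (T.v ∘ₗ T.u)
  FPMod.of (freeModule A T.X₃ ⧸ LinearMap.range (T.v ∘ₗ T.u))

/-- The projection `A^m ⟶ Coker u`. -/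
def leftMk (T : Chain (FreeMod A)) : freeModule A T.X₂ ⟶ (chainLeft T).obj :=
  ModuleCat.ofHom (LinearMap.range T.u).mkQ

/-- The projection `A^p ⟶ Coker (v u)`. -/
def rightMk (T : Chain (FreeMod A)) : freeModule A T.X₃ ⟶ (chainRight T).obj :=
  ModuleCat.ofHom (LinearMap.range (T.v ∘ₗ T.u)).mkQ

theorem leftMk_surjective (T : Chain (FreeMod A)) : Function.Surjective (leftMk T) :=
  Submodule.mkQ_surjective _

theorem rightMk_surjective (T : Chain (FreeMod A)) : Function.Surjective (rightMk T) :=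
  Submodule.mkQ_surjective _

instance (T : Chain (FreeMod A)) : Epi (leftMk T) :=
  (ModuleCat.epi_iff_surjective _).2 (leftMk_surjective T)

instance (T : Chain (FreeMod A)) : Epi (rightMk T) :=
  (ModuleCat.epi_iff_surjective _).2 (rightMk_surjective T)

theorem leftMk_eq_zero_iff (T : Chain (FreeMod A)) (c : freeModule A T.X₂) :
    leftMk T c = 0 ↔ c ∈ LinearMap.range T.u :=
  Submodule.Quotient.mk_eq_zero _

theorem rightMk_eq_zero_iff (T : Chain (FreeMod A)) (c : freeModule A T.X₃) :
    rightMk T c = 0 ↔ c ∈ LinearMap.range (T.v ∘ₗ T.u) :=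
  Submodule.Quotient.mk_eq_zero _

theorem condition_leftMk (T : Chain (FreeMod A)) : T.f₁.hom ≫ leftMk T = 0 := by
  ext1
  exact LinearMap.ext fun c => (leftMk_eq_zero_iff T _).2 ⟨c, rfl⟩

theorem condition_rightMk (T : Chain (FreeMod A)) : T.f₁.hom ≫ T.f₂.hom ≫ rightMk T = 0 := by
  ext1
  exact LinearMap.ext fun c => (rightMk_eq_zero_iff T _).2 ⟨c, rfl⟩

/-- Maps out of `Coker u`. -/
def leftDesc (T : Chain (FreeMod A)) {M : RMod A} (α : freeModule A T.X₂ ⟶ M)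
    (h : T.f₁.hom ≫ α = 0) : (chainLeft T).obj ⟶ M :=
  ModuleCat.ofHom ((LinearMap.range T.u).liftQ α.hom (by
    rintro _ ⟨c, rfl⟩
    exact ConcreteCategory.congr_hom h c))

/-- Maps out of `Coker (v u)`. -/
def rightDesc (T : Chain (FreeMod A)) {M : RMod A} (α : freeModule A T.X₃ ⟶ M)
    (h : T.f₁.hom ≫ T.f₂.hom ≫ α = 0) : (chainRight T).obj ⟶ M :=
  ModuleCat.ofHom ((LinearMap.range (T.v ∘ₗ T.u)).liftQ α.hom (by
    rintro _ ⟨c, rfl⟩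
    exact ConcreteCategory.congr_hom h c))

theorem leftMk_leftDesc (T : Chain (FreeMod A)) {M : RMod A} (α : freeModule A T.X₂ ⟶ M)
    (h : T.f₁.hom ≫ α = 0) : leftMk T ≫ leftDesc T α h = α := rfl

theorem rightMk_rightDesc (T : Chain (FreeMod A)) {M : RMod A} (α : freeModule A T.X₃ ⟶ M)
    (h : T.f₁.hom ≫ T.f₂.hom ≫ α = 0) : rightMk T ≫ rightDesc T α h = α := rfl

/-- The map `Coker u ⟶ Coker (v u)` induced by `v`. -/
def chainArrow (T : Chain (FreeMod A)) : chainLeft T ⟶ chainRight T :=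
  ObjectProperty.homMk (leftDesc T (T.f₂.hom ≫ rightMk T) (condition_rightMk T))

theorem leftMk_chainArrow (T : Chain (FreeMod A)) :
    leftMk T ≫ (chainArrow T).hom = T.f₂.hom ≫ rightMk T := rfl

/-- Maps `α` with `α u = 0` are maps out of `Coker u`, and any `β` with `β v = α` kills `v u`, hence
descends to `Coker (v u)`. -/
theorem omega_iff_injectiveAlong (T : Adelman (FreeMod A)) (M : RMod A) :
    Omega T M ↔ InjectiveAlong (chainArrow T.as) M := by
  constructor
  · intro h x
    obtain ⟨β, hβ⟩ := h (leftMk T.as ≫ x) (by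
      rw [← Category.assoc, condition_leftMk, zero_comp])
    refine ⟨rightDesc T.as β (by
      rw [← hβ, ← Category.assoc, condition_leftMk, zero_comp]), ?_⟩
    rw [← cancel_epi (leftMk T.as), ← Category.assoc, leftMk_chainArrow, Category.assoc,
      rightMk_rightDesc, hβ]
  · intro h α hα
    obtain ⟨y, hy⟩ := h (leftDesc T.as α hα)
    refine ⟨rightMk T.as ≫ y, ?_⟩
    rw [← Category.assoc, ← leftMk_chainArrow, Category.assoc, hy, leftMk_leftDesc]

theorem comm₁_hom {X Y : Chain (FreeMod A)} (α : X ⟶ Y) :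
    α.α₁.hom ≫ Y.f₁.hom = X.f₁.hom ≫ α.α₂.hom :=
  congrArg InducedCategory.Hom.hom α.comm₁

theorem comm₂_hom {X Y : Chain (FreeMod A)} (α : X ⟶ Y) :
    α.α₂.hom ≫ Y.f₂.hom = X.f₂.hom ≫ α.α₃.hom :=
  congrArg InducedCategory.Hom.hom α.comm₂

/-- The functoriality of `Coker u`. -/
def chainLeftMap {X Y : Chain (FreeMod A)} (α : X ⟶ Y) : chainLeft X ⟶ chainLeft Y :=
  ObjectProperty.homMk (leftDesc X (α.α₂.hom ≫ leftMk Y) (by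
    rw [← Category.assoc, ← comm₁_hom, Category.assoc, condition_leftMk, comp_zero]))

/-- The functoriality of `Coker (v u)`. -/
def chainRightMap {X Y : Chain (FreeMod A)} (α : X ⟶ Y) : chainRight X ⟶ chainRight Y :=
  ObjectProperty.homMk (rightDesc X (α.α₃.hom ≫ rightMk Y) (by
    rw [← Category.assoc X.f₂.hom, ← comm₂_hom, Category.assoc, ← Category.assoc, ← comm₁_hom,
      Category.assoc, condition_rightMk, comp_zero]))

theorem leftMk_chainLeftMap {X Y : Chain (FreeMod A)} (α : X ⟶ Y) :
    leftMk X ≫ (chainLeftMap α).hom = α.α₂.hom ≫ leftMk Y := rfl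

theorem rightMk_chainRightMap {X Y : Chain (FreeMod A)} (α : X ⟶ Y) :
    rightMk X ≫ (chainRightMap α).hom = α.α₃.hom ≫ rightMk Y := rfl

theorem chainLeft_hom_ext {X : Chain (FreeMod A)} {M : FPMod A} {f g : chainLeft X ⟶ M}
    (h : leftMk X ≫ f.hom = leftMk X ≫ g.hom) : f = g := by
  ext1
  rwa [← cancel_epi (leftMk X)]

theorem chainRight_hom_ext {X : Chain (FreeMod A)} {M : FPMod A} {f g : chainRight X ⟶ M}
    (h : rightMk X ≫ f.hom = rightMk X ≫ g.hom) : f = g := by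
  ext1
  rwa [← cancel_epi (rightMk X)]

theorem chainArrow_comm {X Y : Chain (FreeMod A)} (α : X ⟶ Y) :
    chainLeftMap α ≫ chainArrow Y = chainArrow X ≫ chainRightMap α := by
  apply chainLeft_hom_ext
  change leftMk X ≫ (chainLeftMap α).hom ≫ (chainArrow Y).hom =
    leftMk X ≫ (chainArrow X).hom ≫ (chainRightMap α).hom
  rw [← Category.assoc, leftMk_chainLeftMap, Category.assoc, leftMk_chainArrow,
    ← Category.assoc, comm₂_hom, ← Category.assoc (leftMk X), leftMk_chainArrow, Category.assoc,
    Category.assoc, rightMk_chainRightMap]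

/-- The functor from chains to arrows in `mod-A`. -/
def chainArrowFunctor (A : Type u) [Ring A] : Chain (FreeMod A) ⥤ Arrow (FPMod A) where
  obj T := Arrow.mk (chainArrow T)
  map {X Y} α := Arrow.homMk (chainLeftMap α) (chainRightMap α) (chainArrow_comm α)
  map_id X := by
    ext1
    · exact chainLeft_hom_ext rfl
    · exact chainRight_hom_ext rfl
  map_comp α β := by
    ext1
    · exact chainLeft_hom_ext rfl
    · exact chainRight_hom_ext rfl

/-! ### Lifting along projections by freeness; full faithfulness and essential surjectivity. -/

theorem exists_free_factor {n : FreeMod A} {K M : RMod A} (φ : freeModule A n ⟶ M) (r : K ⟶ M)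
    (h : ∀ c, φ c ∈ LinearMap.range r.hom) : ∃ s : freeModule A n ⟶ K, s ≫ r = φ := by
  obtain ⟨s, hs⟩ := exists_lift_of_range_le φ.hom r.hom h
  exact ⟨ModuleCat.ofHom s, by ext1; exact hs⟩

theorem exists_factor_of_leftMk {n : FreeMod A} {Y : Chain (FreeMod A)}
    (φ : freeModule A n ⟶ freeModule A Y.X₂) (h : φ ≫ leftMk Y = 0) :
    ∃ s : freeModule A n ⟶ freeModule A Y.X₁, s ≫ Y.f₁.hom = φ :=
  exists_free_factor φ Y.f₁.hom fun c =>
    (leftMk_eq_zero_iff Y _).1 (ConcreteCategory.congr_hom h c)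

theorem exists_factor_of_rightMk {n : FreeMod A} {Y : Chain (FreeMod A)}
    (φ : freeModule A n ⟶ freeModule A Y.X₃) (h : φ ≫ rightMk Y = 0) :
    ∃ s : freeModule A n ⟶ freeModule A Y.X₁, s ≫ Y.f₁.hom ≫ Y.f₂.hom = φ :=
  exists_free_factor φ (Y.f₁.hom ≫ Y.f₂.hom) fun c =>
    (rightMk_eq_zero_iff Y _).1 (ConcreteCategory.congr_hom h c)

/-- The summand `s ≫ Y.f₁` of a homotopy is what disappears in `Coker u`. Conversely, after lifting
`t` to free modules, the remaining difference dies in `Coker u` and so factors through `Y.f₁`. By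
`fpCokerMap_eq_iff`, the right-hand side is equality of the induced maps of functors. -/
theorem homotopic_iff_exists {X Y : Chain (FreeMod A)} (α β : X ⟶ Y) :
    Chain.homotopic (FreeMod A) α β ↔
      ∃ t : chainRight X ⟶ chainLeft Y, chainArrow X ≫ t = chainLeftMap α - chainLeftMap β := by
  rw [Chain.homotopic_iff]
  constructor
  · rintro ⟨s, t, h⟩
    replace h : α.α₂.hom - β.α₂.hom = s.hom ≫ Y.f₁.hom + X.f₂.hom ≫ t.hom :=
      congrArg InducedCategory.Hom.hom h
    have h' : X.f₂.hom ≫ t.hom = α.α₂.hom - β.α₂.hom - s.hom ≫ Y.f₁.hom := by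
      rw [h, add_sub_cancel_left]
    have h'' : X.f₂.hom ≫ t.hom ≫ leftMk Y = α.α₂.hom ≫ leftMk Y - β.α₂.hom ≫ leftMk Y := by
      rw [← Category.assoc, h', Preadditive.sub_comp, Preadditive.sub_comp, Category.assoc,
        condition_leftMk, comp_zero, sub_zero]
    have h₀ : X.f₁.hom ≫ X.f₂.hom ≫ t.hom ≫ leftMk Y = 0 := by
      rw [h'', Preadditive.comp_sub, ← Category.assoc, ← Category.assoc, ← comm₁_hom, ← comm₁_hom,
        Category.assoc, Category.assoc, condition_leftMk, comp_zero, comp_zero, sub_zero]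
    refine ⟨ObjectProperty.homMk (rightDesc X (t.hom ≫ leftMk Y) h₀), chainLeft_hom_ext ?_⟩
    change leftMk X ≫ (chainArrow X).hom ≫ rightDesc X _ h₀ =
      leftMk X ≫ ((chainLeftMap α).hom - (chainLeftMap β).hom)
    rw [← Category.assoc, leftMk_chainArrow, Category.assoc, rightMk_rightDesc, h'',
      Preadditive.comp_sub, leftMk_chainLeftMap, leftMk_chainLeftMap]
  · rintro ⟨t, ht⟩
    obtain ⟨t', ht'⟩ := exists_free_factor (rightMk X ≫ t.hom) (leftMk Y)
      fun _ => leftMk_surjective Y _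
    have h1 : leftMk X ≫ (chainArrow X).hom ≫ t.hom =
        leftMk X ≫ ((chainLeftMap α).hom - (chainLeftMap β).hom) :=
      congrArg (fun γ => leftMk X ≫ InducedCategory.Hom.hom γ) ht
    rw [← Category.assoc, leftMk_chainArrow, Category.assoc, ← ht', Preadditive.comp_sub,
      leftMk_chainLeftMap, leftMk_chainLeftMap] at h1
    obtain ⟨s, hs⟩ := exists_factor_of_leftMk (Y := Y)
      (α.α₂.hom - β.α₂.hom - X.f₂.hom ≫ t') (by
        rw [Preadditive.sub_comp, Preadditive.sub_comp, Category.assoc, h1, sub_self])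
    refine ⟨InducedCategory.homMk s, InducedCategory.homMk t', ?_⟩
    ext1
    change α.α₂.hom - β.α₂.hom = s ≫ Y.f₁.hom + X.f₂.hom ≫ t'
    rw [hs, sub_add_cancel]

/-- The functor `𝐀 ↦ Coker Hom(f, -)`, where `f : Coker u ⟶ Coker (v u)` is induced by `v`. -/
def adelmanFunctor (A : Type u) [Ring A] : Adelman (FreeMod A) ⥤ (FPFun A)ᵒᵖ :=
  CategoryTheory.Quotient.lift _ (chainArrowFunctor A ⋙ fpCokerFunctor A) fun X Y α β h => by
    refine Quiver.Hom.unop_inj ?_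
    exact (fpCokerMap_eq_iff (chainArrow_comm α) (chainArrow_comm β)).2 ((homotopic_iff_exists α β).1 h)

instance : (adelmanFunctor A).Faithful where
  map_injective {X Y} α β h := by
    obtain ⟨α, rfl⟩ := (CategoryTheory.Quotient.functor _).map_surjective α
    obtain ⟨β, rfl⟩ := (CategoryTheory.Quotient.functor _).map_surjective β
    refine CategoryTheory.Quotient.sound _ ((homotopic_iff_exists α β).2 ?_)
    exact (fpCokerMap_eq_iff (chainArrow_comm α) (chainArrow_comm β)).1 (congrArg Quiver.Hom.unop h)

instance : (adelmanFunctor A).Full where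
  map_surjective {X Y} γ := by
    obtain ⟨X⟩ := X
    obtain ⟨Y⟩ := Y
    obtain ⟨a, b, w, hab⟩ := exists_fpCokerMap_eq (f := chainArrow Y) (g := chainArrow X) γ.unop
    obtain ⟨α₂, h₂⟩ := exists_free_factor (leftMk X ≫ a.hom) (leftMk Y)
      fun _ => leftMk_surjective Y _
    obtain ⟨α₃, h₃⟩ := exists_free_factor (rightMk X ≫ b.hom) (rightMk Y)
      fun _ => rightMk_surjective Y _
    have w' : leftMk X ≫ a.hom ≫ (chainArrow Y).hom = leftMk X ≫ (chainArrow X).hom ≫ b.hom :=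
      congrArg (fun γ => leftMk X ≫ InducedCategory.Hom.hom γ) w
    -- The lifts commute with the second maps only modulo the image of `v u`. Subtracting `c ≫
    -- Y.f₁.hom` from `α₂` removes the defect without changing the map on `Coker u`.
    obtain ⟨c, hc⟩ := exists_factor_of_rightMk (Y := Y) (α₂ ≫ Y.f₂.hom - X.f₂.hom ≫ α₃) (by
      rw [Preadditive.sub_comp, Category.assoc, Category.assoc, h₃, ← leftMk_chainArrow,
        ← Category.assoc, h₂, ← Category.assoc X.f₂.hom, ← leftMk_chainArrow, Category.assoc,
        Category.assoc, w', sub_self])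
    have h₂' : (α₂ - c ≫ Y.f₁.hom) ≫ leftMk Y = leftMk X ≫ a.hom := by
      rw [Preadditive.sub_comp, Category.assoc, condition_leftMk, comp_zero, sub_zero, h₂]
    obtain ⟨α₁, h₁⟩ := exists_factor_of_leftMk (Y := Y) (X.f₁.hom ≫ (α₂ - c ≫ Y.f₁.hom)) (by
      rw [Category.assoc, h₂', ← Category.assoc, condition_leftMk, zero_comp])
    let α : X ⟶ Y :=
      { α₁ := InducedCategory.homMk α₁
        α₂ := InducedCategory.homMk (α₂ - c ≫ Y.f₁.hom)
        α₃ := InducedCategory.homMk α₃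
        comm₁ := by ext1; exact h₁
        comm₂ := by
          ext1
          change (α₂ - c ≫ Y.f₁.hom) ≫ Y.f₂.hom = X.f₂.hom ≫ α₃
          rw [Preadditive.sub_comp, Category.assoc, hc, sub_sub_cancel] }
    refine ⟨(CategoryTheory.Quotient.functor _).map α, Quiver.Hom.unop_inj ?_⟩
    rw [hab]
    refine (fpCokerMap_eq_iff (chainArrow_comm α) w).2 ⟨0, ?_⟩
    rw [comp_zero, eq_comm, sub_eq_zero]
    exact chainLeft_hom_ext h₂'

/-- Every arrow of `mod-A` is of the form `Coker u ⟶ Coker (v u)`. -/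
theorem exists_chainArrow_iso {X Y : FPMod A} (f : X ⟶ Y) :
    ∃ T : Chain (FreeMod A), Nonempty (Arrow.mk (chainArrow T) ≅ Arrow.mk f) := by
  obtain ⟨p, q, hq⟩ := exists_free_surjective (A := A) Y.obj
  -- The pullback of `f` and the free cover `q`. It is finitely generated, since it maps onto `X`
  -- with kernel `Ker q`; a free cover of it provides `a` and `v`.
  let P : Submodule Aᵐᵒᵖ (X.obj × (Fin p → A)) :=
    LinearMap.eqLocus (f.hom.hom ∘ₗ LinearMap.fst _ _ _) (q ∘ₗ LinearMap.snd _ _ _)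
  have hP : P.FG := by
    refine Submodule.fg_of_fg_map_of_fg_inf_ker (LinearMap.fst _ _ _) ?_ ?_
    · have : P.map (LinearMap.fst Aᵐᵒᵖ X.obj (Fin p → A)) = ⊤ := by
        rw [eq_top_iff]
        intro x _
        obtain ⟨y, hy⟩ := hq (f.hom x)
        exact ⟨(x, y), hy.symm, rfl⟩
      rw [this]
      exact Module.Finite.fg_top
    · have : P ⊓ LinearMap.ker (LinearMap.fst Aᵐᵒᵖ X.obj (Fin p → A)) =
          (LinearMap.ker q).map (LinearMap.inr _ _ _) := by
        ext ⟨x, y⟩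
        constructor
        · rintro ⟨h, rfl : x = 0⟩
          refine ⟨y, ?_, rfl⟩
          have : f.hom (0 : X.obj) = q y := h
          rw [map_zero] at this
          exact this.symm
        · rintro ⟨y', hy', h⟩
          obtain ⟨rfl, rfl⟩ := Prod.mk.inj h
          exact ⟨(map_zero f.hom.hom).trans hy'.symm, rfl⟩
      rw [this]
      exact (Module.FinitePresentation.fg_ker q hq).map _
  have : Module.Finite Aᵐᵒᵖ P := Module.Finite.iff_fg.2 hP
  obtain ⟨m, e, he⟩ := exists_free_surjective (A := A) P
  let a : (Fin m → A) →ₗ[Aᵐᵒᵖ] X.obj := LinearMap.fst _ _ _ ∘ₗ P.subtype ∘ₗ e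
  let v : (Fin m → A) →ₗ[Aᵐᵒᵖ] (Fin p → A) := LinearMap.snd _ _ _ ∘ₗ P.subtype ∘ₗ e
  have hav (c : Fin m → A) : f.hom (a c) = q (v c) := (e c).2
  have ha : Function.Surjective a := by
    intro x
    obtain ⟨y, hy⟩ := hq (f.hom x)
    obtain ⟨c, hc⟩ := he ⟨(x, y), hy.symm⟩
    exact ⟨c, congrArg (fun z => z.1.1) hc⟩
  have : Module.Finite Aᵐᵒᵖ (LinearMap.ker a) :=
    Module.Finite.iff_fg.2 (Module.FinitePresentation.fg_ker a ha)
  obtain ⟨n, d, hd⟩ := exists_free_surjective (A := A) (LinearMap.ker a)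
  let u : (Fin n → A) →ₗ[Aᵐᵒᵖ] (Fin m → A) := (LinearMap.ker a).subtype ∘ₗ d
  have hu : LinearMap.range u = LinearMap.ker a := by
    rw [LinearMap.range_comp_of_range_eq_top _ (LinearMap.range_eq_top.2 hd), Submodule.range_subtype]
  -- Each `(0, y)` with `q y = 0` lies in the pullback, so `v` maps `Ker a` onto `Ker q`.
  have hvu : LinearMap.range (v ∘ₗ u) = LinearMap.ker q := by
    rw [LinearMap.range_comp, hu]
    ext y
    constructor
    · rintro ⟨c, hc, rfl⟩
      have := hav c
      rw [show a c = 0 from hc, map_zero] at this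
      exact this.symm
    · intro hy
      obtain ⟨c, hc⟩ := he ⟨(0, y), (map_zero f.hom.hom).trans (show q y = 0 from hy).symm⟩
      have h1 : a c = 0 := congrArg (fun z => z.1.1) hc
      exact ⟨c, h1, congrArg (fun z => z.1.2) hc⟩
  let T : Chain (FreeMod A) :=
    { X₁ := n
      X₂ := m
      X₃ := p
      f₁ := InducedCategory.homMk (ModuleCat.ofHom u)
      f₂ := InducedCategory.homMk (ModuleCat.ofHom v) }
  let iX : (chainLeft T).obj ≅ X.obj :=
    ((Submodule.quotEquivOfEq _ _ hu).trans (a.quotKerEquivOfSurjective ha)).toModuleIso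
  let iY : (chainRight T).obj ≅ Y.obj :=
    ((Submodule.quotEquivOfEq _ _ hvu).trans (q.quotKerEquivOfSurjective hq)).toModuleIso
  refine ⟨T, ⟨Arrow.isoMk ((isFinPres A).isoMk iX) ((isFinPres A).isoMk iY) ?_⟩⟩
  refine chainLeft_hom_ext ?_
  ext1
  exact LinearMap.ext fun c => hav c

instance : (adelmanFunctor A).EssSurj where
  mem_essImage F := by
    obtain ⟨X, Y, f, ⟨e⟩⟩ := exists_iso_fpCoker F.unop
    obtain ⟨T, ⟨i⟩⟩ := exists_chainArrow_iso f
    exact ⟨⟨T⟩, ⟨(fpCokerFunctor A).mapIso i ≪≫ e.op.symm⟩⟩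

instance : (adelmanFunctor A).IsEquivalence where

end Equivalence

/-! ### Maps from finitely presented modules to direct limits -/

section DirectLimits

variable {A : Type u} [Ring A]

theorem exists_desc_of_surjective {P Q M : Type*} [AddCommGroup P] [Module Aᵐᵒᵖ P]
    [AddCommGroup Q] [Module Aᵐᵒᵖ Q] [AddCommGroup M] [Module Aᵐᵒᵖ M] (q : P →ₗ[Aᵐᵒᵖ] Q)
    (hq : Function.Surjective q) (g : P →ₗ[Aᵐᵒᵖ] M) (h : LinearMap.ker q ≤ LinearMap.ker g) :
    ∃ g' : Q →ₗ[Aᵐᵒᵖ] M, g' ∘ₗ q = g := by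
  refine ⟨(LinearMap.ker q).liftQ g h ∘ₗ (q.quotKerEquivOfSurjective hq).symm, ?_⟩
  ext x
  have : (q.quotKerEquivOfSurjective hq).symm (q x) = (LinearMap.ker q).mkQ x := by
    rw [LinearEquiv.symm_apply_eq]
    rfl
  simp [this]

variable {J : Type w} [Preorder J] [IsDirectedOrder J] [Nonempty J]
  [PreservesColimitsOfShape J (forget (RMod A))] {F : J ⥤ RMod A} {c : Cocone F}

theorem exists_rep_of_isColimit (hc : IsColimit c) {ι : Type*} [Finite ι] (x : ι → c.pt) :
    ∃ (j : J) (x' : ι → F.obj j), ∀ i, c.ι.app j (x' i) = x i := by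
  choose j x' h using fun i => Concrete.isColimit_exists_rep F hc (x i)
  obtain ⟨k, hk⟩ := Finite.exists_le j
  refine ⟨k, fun i => F.map (homOfLE (hk i)) (x' i), fun i => ?_⟩
  rw [← h i]
  exact ConcreteCategory.congr_hom (c.w (homOfLE (hk i))) (x' i)

theorem exists_eq_zero_of_isColimit (hc : IsColimit c) {ι : Type*} [Finite ι] {j : J} (x : ι → F.obj j)
    (hx : ∀ i, c.ι.app j (x i) = 0) : ∃ (k : J) (h : j ⟶ k), ∀ i, F.map h (x i) = 0 := by
  have (i : ι) : ∃ (k : J) (h : j ⟶ k), F.map h (x i) = 0 := by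
    obtain ⟨k, h, e⟩ := (hc.eq_iff' (x i) 0).1 ((hx i).trans (map_zero _).symm)
    exact ⟨k, h, e.trans (map_zero _)⟩
  choose k h e using this
  obtain ⟨l, hl⟩ := Finite.exists_le k
  obtain ⟨m, hm, hm'⟩ := exists_ge_ge l j
  refine ⟨m, homOfLE hm', fun i => ?_⟩
  have : homOfLE hm' = h i ≫ homOfLE ((hl i).trans hm) := rfl
  rw [this, F.map_comp, ConcreteCategory.comp_apply, e, map_zero]

theorem exists_comp_map_eq_zero (hc : IsColimit c) {Y : RMod A} [Module.Finite Aᵐᵒᵖ Y] {j : J} (f : Y ⟶ F.obj j)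
    (hf : f ≫ c.ι.app j = 0) : ∃ (k : J) (h : j ⟶ k), f ≫ F.map h = 0 := by
  obtain ⟨n, q, hq⟩ := exists_free_surjective (A := A) Y
  obtain ⟨k, h, e⟩ := exists_eq_zero_of_isColimit hc (fun i => f (q (Pi.single i 1)))
    fun i => ConcreteCategory.congr_hom hf _
  refine ⟨k, h, ?_⟩
  have e' : (F.map h).hom ∘ₗ f.hom ∘ₗ q = 0 := free_hom_ext e
  ext y
  obtain ⟨y, rfl⟩ := hq y
  exact LinearMap.congr_fun e' y

theorem exists_comp_map_eq (hc : IsColimit c) {Y : RMod A} [Module.Finite Aᵐᵒᵖ Y] {j : J} (f f' : Y ⟶ F.obj j)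
    (hf : f ≫ c.ι.app j = f' ≫ c.ι.app j) : ∃ (k : J) (h : j ⟶ k), f ≫ F.map h = f' ≫ F.map h := by
  obtain ⟨k, h, e⟩ := exists_comp_map_eq_zero hc (f - f') (by
    rw [Preadditive.sub_comp, hf, sub_self])
  exact ⟨k, h, by rwa [Preadditive.sub_comp, sub_eq_zero] at e⟩

theorem exists_lift_of_isColimit (hc : IsColimit c) {Y : RMod A} [Module.FinitePresentation Aᵐᵒᵖ Y] (f : Y ⟶ c.pt) :
    ∃ (j : J) (f' : Y ⟶ F.obj j), f' ≫ c.ι.app j = f := by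
  obtain ⟨n, q, hq⟩ := exists_free_surjective (A := A) Y
  obtain ⟨j, x, hx⟩ := exists_rep_of_isColimit hc fun i => f (q (Pi.single i 1))
  have h0 : (c.ι.app j).hom ∘ₗ freeLift x = f.hom ∘ₗ q := free_hom_ext fun i => by
    rw [LinearMap.comp_apply, freeLift_single]
    exact hx i
  have : Module.Finite Aᵐᵒᵖ (LinearMap.ker q) :=
    Module.Finite.iff_fg.2 (Module.FinitePresentation.fg_ker q hq)
  obtain ⟨k, h, e⟩ := exists_comp_map_eq_zero hc
    (Y := ModuleCat.of Aᵐᵒᵖ (LinearMap.ker q))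
    (ModuleCat.ofHom (freeLift x ∘ₗ (LinearMap.ker q).subtype)) (by
      ext1
      refine LinearMap.ext fun d => ?_
      refine (LinearMap.congr_fun h0 d.1).trans ?_
      rw [LinearMap.comp_apply, show q d.1 = 0 from d.2, map_zero]
      rfl)
  have e' (d : LinearMap.ker q) : (F.map h).hom (freeLift x d.1) = 0 :=
    ConcreteCategory.congr_hom e d
  obtain ⟨g, hg⟩ := exists_desc_of_surjective q hq ((F.map h).hom ∘ₗ freeLift x) fun d hd =>
    e' ⟨d, hd⟩
  refine ⟨k, ModuleCat.ofHom g, ?_⟩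
  ext y
  obtain ⟨y, rfl⟩ := hq y
  change c.ι.app k (g (q y)) = f (q y)
  rw [show g (q y) = F.map h (freeLift x y) from LinearMap.congr_fun hg y]
  exact (ConcreteCategory.congr_hom (c.w h) _).trans (LinearMap.congr_fun h0 y)

end DirectLimits

/-! ### Reduced products -/

section ReducedProducts

variable {A : Type u} [Ring A] {J : Type u} [Preorder J]

/-- The direct system of the products `∏_{k ≥ j} N_k`, whose colimit is the reduced product of the
modules `N_k`. -/
def tailProducts (N : J → RMod A) : J ⥤ RMod A where
  obj j := ModuleCat.of Aᵐᵒᵖ (∀ k : Set.Ici j, N k)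
  map {j j'} h := ModuleCat.ofHom
    { toFun := fun x k => x ⟨k.1, (leOfHom h).trans k.2⟩
      map_add' := fun _ _ => rfl
      map_smul' := fun _ _ => rfl }

/-- The projections of `∏_{k ≥ j} N_k`. -/
def tailProj (N : J → RMod A) {j k : J} (h : j ≤ k) : (tailProducts N).obj j ⟶ N k :=
  ModuleCat.ofHom (LinearMap.proj (⟨k, h⟩ : Set.Ici j))

/-- Maps into `∏_{k ≥ j} N_k`. -/
def tailLift (N : J → RMod A) (j : J) {Y : RMod A} (f : ∀ k, j ≤ k → (Y ⟶ N k)) :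
    Y ⟶ (tailProducts N).obj j :=
  ModuleCat.ofHom (LinearMap.pi fun k : Set.Ici j => (f k.1 k.2).hom)

theorem tail_hom_ext (N : J → RMod A) {j : J} {Y : RMod A} {f g : Y ⟶ (tailProducts N).obj j}
    (h : ∀ (k : J) (hk : j ≤ k), f ≫ tailProj N hk = g ≫ tailProj N hk) : f = g := by
  ext1
  refine LinearMap.ext fun y => funext fun k => ?_
  exact ConcreteCategory.congr_hom (h k.1 k.2) y

end ReducedProducts

/-! ### Separating a functor from a Serre subcategory by a module -/

section Separation

variable {A : Type u} [Ring A] {S : ObjectProperty (FPFun A)}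

/-- `x : X ⟶ N` is `S`-small if `Coker Hom(g, -)` is in `S` whenever `x` factors through a map
`g : X ⟶ Y` in `mod-A`. -/
def IsSmallFor (S : ObjectProperty (FPFun A)) {X : FPMod A} {N : RMod A} (x : X.obj ⟶ N) : Prop :=
  ∀ (Y : FPMod A) (g : X ⟶ Y) (y : Y.obj ⟶ N), g.hom ≫ y = x → S (fpCoker g)

/-- If `𝟙 X` factors through `g`, then `g` is a split monomorphism and its functor is zero. -/
theorem IsSerre.isSmallFor_id (hS : IsSerre S) (X : FPMod A) : IsSmallFor S (𝟙 X.obj) := by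
  intro Y g y h
  refine hS.fpCoker_of_comp g (ObjectProperty.homMk y) ?_
  have : g ≫ ObjectProperty.homMk y = 𝟙 X := by ext1; exact h
  rw [this]
  exact hS.fpCoker_id X

/-- Smallness is inherited by pushouts along a map in `mod-A` with cokernel functor in `S`. -/
theorem IsSerre.exists_isSmallFor_extension (hS : IsSerre S) {X₀ : FPMod A} {N : RMod A}
    {x : X₀.obj ⟶ N} (hx : IsSmallFor S x) {X Y : FPMod A} {f : X ⟶ Y} (hf : S (fpCoker f))
    (a : X.obj ⟶ N) :
    ∃ (N' : RMod A) (k : N ⟶ N') (y : Y.obj ⟶ N'), f.hom ≫ y = a ≫ k ∧ IsSmallFor S (x ≫ k) := by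
  let ρ : X.obj →ₗ[Aᵐᵒᵖ] N × Y.obj := LinearMap.prod a.hom (-f.hom.hom)
  let π := (LinearMap.range ρ).mkQ
  have hπ : Function.Surjective π := Submodule.mkQ_surjective _
  have hπ0 (z : N × Y.obj) : π z = 0 ↔ ∃ t, ρ t = z := Submodule.Quotient.mk_eq_zero _
  refine ⟨ModuleCat.of Aᵐᵒᵖ ((N × Y.obj) ⧸ LinearMap.range ρ),
    ModuleCat.ofHom (π ∘ₗ LinearMap.inl _ _ _), ModuleCat.ofHom (π ∘ₗ LinearMap.inr _ _ _), ?_, ?_⟩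
  · ext t
    change π (0, f.hom t) = π (a t, 0)
    rw [eq_comm, ← sub_eq_zero, ← map_sub, hπ0]
    exact ⟨t, by simp [ρ]⟩
  intro Y' g y' hg
  -- The factorization through the pushout is now approximated by finitely presented modules. `E`
  -- covers `Y'` by `ψ` and lifts `y'` by `θ`, so `θ` sends each of the finitely many generators `d`
  -- of `Ker ψ` to some `ρ (τ d)`.
  obtain ⟨p, e, he⟩ := exists_free_surjective (A := A) Y'.obj
  obtain ⟨l, hl⟩ := exists_lift_of_range_le (y'.hom ∘ₗ e) π fun _ => hπ _
  let E := X₀.obj × X.obj × (Fin p → A)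
  let θ : E →ₗ[Aᵐᵒᵖ] N × Y.obj :=
    LinearMap.coprod (LinearMap.inl _ _ _ ∘ₗ x.hom) (LinearMap.coprod ρ l)
  let ψ : E →ₗ[Aᵐᵒᵖ] Y'.obj := LinearMap.coprod g.hom.hom (LinearMap.coprod 0 e)
  have hθ (z : X₀.obj) (t : X.obj) (c : Fin p → A) : θ (z, t, c) = (x z, 0) + (ρ t + l c) := rfl
  have hψ' (z : X₀.obj) (t : X.obj) (c : Fin p → A) : ψ (z, t, c) = g.hom z + (0 + e c) := rfl
  have hψ : Function.Surjective ψ := fun z => by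
    obtain ⟨c, rfl⟩ := he z
    exact ⟨(0, 0, c), by rw [hψ', map_zero, zero_add, zero_add]⟩
  have hθ₀ (z : X₀.obj) : θ (z, 0, 0) = (x z, 0) := by
    rw [hθ, map_zero, map_zero, add_zero, add_zero]
  have hcomm (d : E) : π (θ d) = y' (ψ d) := by
    obtain ⟨z, t, c⟩ := d
    have h1 : π (x z, 0) = y' (g.hom z) := (ConcreteCategory.congr_hom hg z).symm
    have h2 : π (ρ t) = 0 := (hπ0 _).2 ⟨t, rfl⟩
    have h3 : π (l c) = y' (e c) := LinearMap.congr_fun hl c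
    rw [hθ, hψ', map_add, map_add, map_add, map_add, h1, h2, h3, map_zero]
  obtain ⟨D, hD⟩ := Module.FinitePresentation.fg_ker ψ hψ
  have ht (d : E) (hd : d ∈ LinearMap.ker ψ) : ∃ t, ρ t = θ d := by
    rw [← hπ0, hcomm, show ψ d = 0 from hd, map_zero]
  have hDmem (d : D) : (d : E) ∈ LinearMap.ker ψ := hD ▸ Submodule.subset_span d.2
  choose τ hτ using fun d : D => ht d (hDmem d)
  let L : Submodule Aᵐᵒᵖ E := Submodule.span Aᵐᵒᵖ (Set.range fun d : D => (d : E) - (0, τ d, 0))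
  have hLfg : L.FG := Submodule.fg_span (Set.finite_range _)
  have : Module.FinitePresentation Aᵐᵒᵖ (E ⧸ L) :=
    Module.finitePresentation_of_surjective L.mkQ (Submodule.mkQ_surjective _)
      (by rwa [Submodule.ker_mkQ])
  have hLθ : L ≤ LinearMap.ker θ := by
    rw [Submodule.span_le]
    rintro _ ⟨d, rfl⟩
    have : θ (0, τ d, 0) = ρ (τ d) := by
      rw [hθ, map_zero, map_zero, add_zero, Prod.mk_zero_zero, zero_add]
    change θ ((d : E) - (0, τ d, 0)) = 0
    rw [map_sub, this, hτ, sub_self]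
  -- Only the relations `d = (0, τ d, 0)` are imposed, so `θ` descends. Its first component gives a
  -- factorization of `x` through `x₀ : X₀ ⟶ Q`, to which smallness of `x` applies.
  let Q : FPMod A := FPMod.of (E ⧸ L)
  let θ' : (E ⧸ L) →ₗ[Aᵐᵒᵖ] N × Y.obj := L.liftQ θ hLθ
  let x₀ : X₀ ⟶ Q := ObjectProperty.homMk (ModuleCat.ofHom (L.mkQ ∘ₗ LinearMap.inl _ _ _))
  let ρ₀ : X ⟶ Q := ObjectProperty.homMk
    (ModuleCat.ofHom (L.mkQ ∘ₗ LinearMap.inr _ _ _ ∘ₗ LinearMap.inl _ _ _))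
  obtain ⟨P, i, j, hij, hP⟩ := exists_weakPushout ρ₀ f
  have hx₀ : S (fpCoker x₀) := by
    refine hx Q x₀ (ModuleCat.ofHom (LinearMap.fst _ _ _ ∘ₗ θ')) ?_
    ext z
    exact congrArg Prod.fst (hθ₀ z)
  have hi : S (fpCoker i) := hS.fpCoker_cobaseChange f ρ₀ i j hij hP hf
  -- On a generator `d` of `Ker ψ`, the first term is `j (f (τ d))` and the second its negative.
  -- Hence `σ` induces `r` on `Y'` with `g ≫ r = x₀ ≫ i`, and cancellation applies to `g`.
  let σ : E →ₗ[Aᵐᵒᵖ] P.obj := i.hom.hom ∘ₗ L.mkQ + j.hom.hom ∘ₗ LinearMap.snd _ _ _ ∘ₗ θ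
  have hij' (t : X.obj) : i.hom (L.mkQ (0, t, 0)) = j.hom (f.hom t) :=
    ConcreteCategory.congr_hom (congrArg InducedCategory.Hom.hom hij) t
  have hσ : LinearMap.ker ψ ≤ LinearMap.ker σ := by
    rw [← hD, Submodule.span_le]
    intro d hd
    have h1 : L.mkQ d = L.mkQ (0, τ ⟨d, hd⟩, 0) := by
      rw [← sub_eq_zero, ← map_sub, Submodule.mkQ_apply, Submodule.Quotient.mk_eq_zero]
      exact Submodule.subset_span ⟨⟨d, hd⟩, rfl⟩
    have h2 : (θ d).2 = -f.hom (τ ⟨d, hd⟩) := by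
      rw [← hτ ⟨d, hd⟩]
      rfl
    change i.hom (L.mkQ d) + j.hom (θ d).2 = 0
    rw [h1, h2, hij', map_neg, add_neg_cancel]
  obtain ⟨r, hr⟩ := exists_desc_of_surjective ψ hψ σ hσ
  refine hS.fpCoker_of_comp g (ObjectProperty.homMk (ModuleCat.ofHom r)) ?_
  have : g ≫ ObjectProperty.homMk (ModuleCat.ofHom r) = x₀ ≫ i := by
    ext z
    have h1 : r (ψ (z, 0, 0)) = σ (z, 0, 0) := LinearMap.congr_fun hr (z, 0, 0)
    have h2 : ψ (z, 0, 0) = g.hom z := by rw [hψ', map_zero, add_zero, add_zero]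
    change r (g.hom z) = i.hom (L.mkQ (z, 0, 0))
    rw [← h2, h1]
    change i.hom (L.mkQ (z, 0, 0)) + j.hom (θ (z, 0, 0)).2 = _
    rw [hθ₀, map_zero, add_zero]
  rw [this]
  exact hS.fpCoker_comp x₀ i hx₀ hi

/-- Finitely many extension problems can be solved simultaneously. -/
theorem IsSerre.exists_isSmallFor_finset (hS : IsSerre S) {X₀ : FPMod A} {N : RMod A}
    {x : X₀.obj ⟶ N} (hx : IsSmallFor S x) {I : Type*} (X Y : I → FPMod A) (f : ∀ i, X i ⟶ Y i)
    (hf : ∀ i, S (fpCoker (f i))) (a : ∀ i, (X i).obj ⟶ N) (s : Finset I) :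
    ∃ (N' : RMod A) (k : N ⟶ N'), IsSmallFor S (x ≫ k) ∧
      ∀ i ∈ s, ∃ y : (Y i).obj ⟶ N', (f i).hom ≫ y = a i ≫ k := by
  classical
  induction s using Finset.induction_on with
  | empty => exact ⟨N, 𝟙 N, by rwa [Category.comp_id], fun i hi => by simp at hi⟩
  | insert i s _ ih =>
    obtain ⟨N', k, hk, h⟩ := ih
    obtain ⟨N'', k', y, hy, hk'⟩ := hS.exists_isSmallFor_extension hk (hf i) (a i ≫ k)
    refine ⟨N'', k ≫ k', by rwa [← Category.assoc], fun j hj => ?_⟩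
    obtain rfl | hj := Finset.mem_insert.1 hj
    · exact ⟨y, by rw [hy, Category.assoc]⟩
    · obtain ⟨z, hz⟩ := h j hj
      exact ⟨z ≫ k', by rw [← Category.assoc, hz, Category.assoc]⟩

/-- Arbitrary small families of extension problems can be solved simultaneously. -/
theorem IsSerre.exists_isSmallFor_family (hS : IsSerre S) {X₀ : FPMod A} {N : RMod A}
    {x : X₀.obj ⟶ N} (hx : IsSmallFor S x) {I : Type u} (X Y : I → FPMod A) (f : ∀ i, X i ⟶ Y i)
    (hf : ∀ i, S (fpCoker (f i))) (a : ∀ i, (X i).obj ⟶ N) :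
    ∃ (N' : RMod A) (k : N ⟶ N'), IsSmallFor S (x ≫ k) ∧
      ∀ i, ∃ y : (Y i).obj ⟶ N', (f i).hom ≫ y = a i ≫ k := by
  classical
  choose Q q hq y hy using hS.exists_isSmallFor_finset hx X Y f hf a
  -- In the reduced product over finite subsets of `I`, problem `i` is solved from stage `{i}` on,
  -- because every `Q s` with `i ∈ s` solves it.
  let F := tailProducts Q
  let k₀ : N ⟶ F.obj ∅ := tailLift Q ∅ fun s _ => q s
  refine ⟨colimit F, k₀ ≫ colimit.ι F ∅, ?_, fun i => ?_⟩
  · intro Y' g y' hg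
    obtain ⟨s, z, rfl⟩ := exists_lift_of_isColimit (colimit.isColimit F) y'
    have e : (∅ : Finset I) ≤ s := Finset.empty_subset s
    obtain ⟨t, h, ht⟩ := exists_comp_map_eq (colimit.isColimit F) (g.hom ≫ z)
      (x ≫ k₀ ≫ F.map (homOfLE e)) (by
        rw [Category.assoc, hg, Category.assoc, Category.assoc]
        exact congrArg (fun r => x ≫ k₀ ≫ r) (colimit.w F (homOfLE e)).symm)
    -- A factorization through the colimit already exists at stage `t`; its coordinate at `t` is a
    -- factorization in `Q t`, where smallness is known.
    refine hq t Y' g (z ≫ F.map h ≫ tailProj Q le_rfl) ?_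
    have := congrArg (fun r => r ≫ tailProj Q le_rfl) ht
    simp only [Category.assoc] at this
    rw [this]
    rfl
  · have e : (∅ : Finset I) ≤ {i} := Finset.empty_subset _
    refine ⟨tailLift Q {i} (fun s hs => y s i (hs (Finset.mem_singleton_self i))) ≫
      colimit.ι F {i}, ?_⟩
    rw [← Category.assoc, ← colimit.w F (homOfLE e), ← Category.assoc, ← Category.assoc]
    congr 1
    exact tail_hom_ext Q fun s hs => hy s i _

/-- A module together with an `S`-small map from `X₀`. -/
structure SmallExtension (S : ObjectProperty (FPFun A)) (X₀ : FPMod A) where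
  N : RMod A
  x : X₀.obj ⟶ N
  isSmallFor : IsSmallFor S x

/-- Chains of free modules form a type in `Type u`, so all extension problems make up a small
family; up to isomorphism they cover every arrow of `mod-A`. -/
theorem IsSerre.exists_smallExtension (hS : IsSerre S) {X₀ : FPMod A} (E : SmallExtension S X₀) :
    ∃ (E' : SmallExtension S X₀) (k : E.N ⟶ E'.N), E.x ≫ k = E'.x ∧
      ∀ T : Chain (FreeMod A), S (fpCoker (chainArrow T)) → ∀ a : (chainLeft T).obj ⟶ E.N,
        ∃ y : (chainRight T).obj ⟶ E'.N, (chainArrow T).hom ≫ y = a ≫ k := by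
  let I := Σ T : {T : Chain (FreeMod A) // S (fpCoker (chainArrow T))},
    ((chainLeft T.1).obj ⟶ E.N)
  obtain ⟨N', k, h, h'⟩ := hS.exists_isSmallFor_family E.isSmallFor (I := I)
    (fun i => chainLeft i.1.1) (fun i => chainRight i.1.1) (fun i => chainArrow i.1.1)
    (fun i => i.1.2) (fun i => i.2)
  exact ⟨⟨N', E.x ≫ k, h⟩, k, rfl, fun T hT a => h' ⟨⟨T, hT⟩, a⟩⟩

instance : PreservesColimitsOfShape ℕ (forget (RMod A)) :=
  have := preservesFilteredColimitsOfSize_shrink.{0, u, 0, u} (forget (RMod A))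
  PreservesFilteredColimitsOfSize.preserves_filtered_colimits ℕ

theorem IsSerre.exists_sequence (hS : IsSerre S) (X₀ : FPMod A) :
    ∃ (F : ℕ ⥤ RMod A) (x : ∀ n, X₀.obj ⟶ F.obj n),
      (∀ n, x n ≫ F.map (homOfLE (Nat.le_add_right n 1)) = x (n + 1)) ∧
      (∀ n, IsSmallFor S (x n)) ∧
      ∀ (n : ℕ) (T : Chain (FreeMod A)), S (fpCoker (chainArrow T)) →
        ∀ a : (chainLeft T).obj ⟶ F.obj n, ∃ y : (chainRight T).obj ⟶ F.obj (n + 1),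
          (chainArrow T).hom ≫ y = a ≫ F.map (homOfLE (Nat.le_add_right n 1)) := by
  choose next k hk hnext using hS.exists_smallExtension (X₀ := X₀)
  let E (n : ℕ) : SmallExtension S X₀ :=
    Nat.rec ⟨X₀.obj, 𝟙 _, hS.isSmallFor_id X₀⟩ (fun _ e => next e) n
  refine ⟨Functor.ofSequence (X := fun n => (E n).N) fun n => k (E n), fun n => (E n).x,
    fun n => ?_, fun n => (E n).isSmallFor, fun n T hT a => ?_⟩
  · rw [Functor.ofSequence_map_homOfLE_succ]
    exact hk (E n)
  · rw [Functor.ofSequence_map_homOfLE_succ]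
    exact hnext (E n) T hT a

/-- If `Coker Hom(g, -)` is not in the Serre subcategory `S`, there is a module on which all
functors in `S` vanish and which is not injective with respect to `g`. -/
theorem IsSerre.exists_module (hS : IsSerre S) {X₀ Y₀ : FPMod A} (g : X₀ ⟶ Y₀)
    (hg : ¬ S (fpCoker g)) :
    ∃ M : RMod A, (∀ T : Chain (FreeMod A), S (fpCoker (chainArrow T)) →
      InjectiveAlong (chainArrow T) M) ∧ ¬ InjectiveAlong g M := by
  obtain ⟨F, x, hsucc, hsmall, hsolve⟩ := hS.exists_sequence X₀
  have hx (n : ℕ) : x n ≫ colimit.ι F n = x 0 ≫ colimit.ι F 0 := by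
    induction n with
    | zero => rfl
    | succ n ih =>
      rw [← ih, ← hsucc, Category.assoc, colimit.w]
  have hmap {m n : ℕ} (h : m ⟶ n) : x m ≫ F.map h = x n := by
    obtain ⟨d, rfl⟩ := Nat.exists_eq_add_of_le (leOfHom h)
    induction d with
    | zero =>
      have : h = 𝟙 _ := rfl
      rw [this, F.map_id]
      exact Category.comp_id _
    | succ d ih =>
      have : h = homOfLE (Nat.le_add_right m d) ≫ homOfLE (Nat.le_add_right (m + d) 1) := rfl
      rw [this, F.map_comp, ← Category.assoc, ih]
      exact hsucc _
  refine ⟨colimit F, fun T hT a => ?_, fun h => hg ?_⟩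
  · obtain ⟨n, a, rfl⟩ := exists_lift_of_isColimit (colimit.isColimit F) a
    obtain ⟨y, hy⟩ := hsolve n T hT a
    refine ⟨y ≫ colimit.ι F (n + 1), ?_⟩
    rw [← Category.assoc, hy, Category.assoc, colimit.w]
    rfl
  · obtain ⟨y, hy⟩ := h (x 0 ≫ colimit.ι F 0)
    obtain ⟨n, y, rfl⟩ := exists_lift_of_isColimit (colimit.isColimit F) y
    obtain ⟨m, r, hr⟩ := exists_comp_map_eq (colimit.isColimit F) (g.hom ≫ y) (x n) (by
      rw [Category.assoc, hy]
      exact (hx n).symm)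
    refine hsmall m Y₀ g (y ≫ F.map r) ?_
    rw [← Category.assoc, hr, hmap]

end Separation

/-! ### Definable subcategories -/

section Definable

variable {A : Type u} [Ring A]

/-- Products: extend coordinatewise. Direct limits: a map from the finitely presented `Coker u`
lives at one stage. Pure subobjects: solving `α = β v` for `β` is a finite linear system. -/
theorem isDefinable_omegaClass (S : ObjectProperty (Adelman (FreeMod A))) :
    IsDefinable (omegaClass S) where
  products ι := ⟨by
    rintro M ⟨p⟩ T hT
    rw [omega_iff_injectiveAlong]
    intro x
    have (j : Discrete ι) : ∃ y : (chainRight T.as).obj ⟶ p.diag.obj j,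
        (chainArrow T.as).hom ≫ y = x ≫ p.π.app j :=
      (omega_iff_injectiveAlong T _).1 (p.prop_diag_obj j T hT) _
    choose y hy using this
    let c : Cone p.diag := { pt := (chainRight T.as).obj, π := Discrete.natTrans fun j => y j }
    refine ⟨p.isLimit.lift c, p.isLimit.hom_ext fun j => ?_⟩
    rw [Category.assoc, p.isLimit.fac]
    exact hy j⟩
  directLimits J := ⟨by
    rintro M ⟨p⟩ T hT
    rw [omega_iff_injectiveAlong]
    intro x
    obtain ⟨j, x, rfl⟩ := exists_lift_of_isColimit p.isColimit x
    obtain ⟨y, rfl⟩ := (omega_iff_injectiveAlong T _).1 (p.prop_diag_obj j T hT) x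
    exact ⟨y ≫ p.ι.app j, (Category.assoc _ _ _).symm⟩⟩
  pureSubobjects := by
    intro M N f hf hN T hT α hα
    obtain ⟨β, hβ⟩ := hN T hT (α ≫ f) (by rw [← Category.assoc, hα, zero_comp])
    let e (j : Fin T.as.X₂) : freeModule A T.as.X₂ := Pi.single j 1
    -- The matrix is that of `v`, the unknowns are the values of `β` on the basis, and the constants
    -- are the values of `α`.
    obtain ⟨z, hz⟩ := hf.2 T.as.X₃ T.as.X₂ (fun i j => T.as.v (e j) i) (fun j => α (e j))
      ⟨fun i => β (Pi.single i (1 : A) : Fin T.as.X₃ → A), fun j =>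
        (LinearMap.congr_fun (freeLift_eq β.hom) (T.as.v (e j))).trans
          (ConcreteCategory.congr_hom hβ (e j)).symm⟩
    refine ⟨ModuleCat.ofHom (freeLift z), ?_⟩
    ext1
    exact free_hom_ext fun j => (hz j).symm

/-! ### Pure embeddings into reduced products. -/

theorem finitePresentation_quotient_span {E : Type u} [AddCommGroup E] [Module Aᵐᵒᵖ E]
    [Module.FinitePresentation Aᵐᵒᵖ E] {s : Set E} (hs : s.Finite) :
    Module.FinitePresentation Aᵐᵒᵖ (E ⧸ Submodule.span Aᵐᵒᵖ s) :=
  Module.finitePresentation_of_surjective (Submodule.mkQ _) (Submodule.mkQ_surjective _)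
    (by rw [Submodule.ker_mkQ]; exact Submodule.fg_span hs)

theorem IsDefinable.prop_pi {D : ObjectProperty (RMod A)} (hD : IsDefinable D) {ι : Type u}
    (N : ι → RMod A) (hN : ∀ i, D (N i)) : D (ModuleCat.of Aᵐᵒᵖ (∀ i, N i)) := by
  have := hD.products ι
  exact D.prop_of_isLimit (ModuleCat.HasLimit.productLimitCone N).isLimit fun j => hN j.as

/-- The relations between the elements of `M`. -/
noncomputable abbrev relations (M : RMod A) : Submodule Aᵐᵒᵖ (M →₀ Aᵐᵒᵖ) :=
  LinearMap.ker (Finsupp.linearCombination Aᵐᵒᵖ (id : M → M))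

/-- If a system of linear equations with constants in `M` is not solvable, then it is not solvable
for some interpretation of the constants in a module in `D` which respects finitely many given
relations. -/
theorem exists_not_solvable {D : ObjectProperty (RMod A)} {M : RMod A}
    (hM : ∀ (X Y : FPMod A) (f : X ⟶ Y), (∀ N, D N → InjectiveAlong f N) → InjectiveAlong f M)
    (R : Finset (relations M)) {m n : ℕ} (U : Matrix (Fin m) (Fin n) A) (x : Fin n → M)
    (hx : ¬ ∃ z : Fin m → M, ∀ j, ∑ i, op (U i j) • z i = x j) :
    ∃ (N : RMod A) (h : (M →₀ Aᵐᵒᵖ) →ₗ[Aᵐᵒᵖ] N), D N ∧ (∀ k ∈ R, h k.1 = 0) ∧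
      ¬ ∃ y : Fin m → N, ∀ j, ∑ i, op (U i j) • y i = h (Finsupp.single (x j) 1) := by
  classical
  by_contra! hcon
  -- Only finitely many elements of `M` occur in the relations `R` and the constants `x`; `E` is
  -- free on them.
  let s : Finset M := R.biUnion (fun k => k.1.support) ∪ Finset.univ.image x
  let E := s →₀ Aᵐᵒᵖ
  let emb : E →ₗ[Aᵐᵒᵖ] (M →₀ Aᵐᵒᵖ) := Finsupp.lmapDomain Aᵐᵒᵖ Aᵐᵒᵖ Subtype.val
  let ret : (M →₀ Aᵐᵒᵖ) →ₗ[Aᵐᵒᵖ] E := Finsupp.lcomapDomain Subtype.val Subtype.val_injective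
  have hret (p : M →₀ Aᵐᵒᵖ) (hp : (p.support : Set M) ⊆ s) : emb (ret p) = p :=
    Finsupp.mapDomain_comapDomain _ Subtype.val_injective p (by simpa using hp)
  let ε := Finsupp.linearCombination Aᵐᵒᵖ (id : M → M)
  have hk (k : relations M) (hk : k ∈ R) : ε (emb (ret k.1)) = 0 := by
    rw [hret]
    · exact k.2
    · intro y hy
      exact Finset.mem_union_left _ (Finset.mem_biUnion.2 ⟨k, hk, hy⟩)
  have hxj (j : Fin n) : ε (emb (ret (Finsupp.single (x j) 1))) = x j := by
    rw [hret]
    · simp [ε]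
    · intro y hy
      have : y = x j := by
        have := Finsupp.support_single_subset hy
        simpa using this
      rw [this]
      exact Finset.mem_union_right _ (Finset.mem_image_of_mem x (Finset.mem_univ j))
  let col (j : Fin n) : Fin m → A := fun i => U i j
  -- `X` is presented by the symbols in `s` and the relations `R`; `Y` adjoins `m` unknowns and the
  -- equations of the system. Extending a map along `X ⟶ Y` means solving the system.
  let sX : Set E := (fun k : relations M => ret k.1) '' R
  let sY : Set (E × (Fin m → A)) := (fun k : relations M => (ret k.1, 0)) '' R ∪
    Set.range fun j => (ret (Finsupp.single (x j) 1), -col j)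
  let LX := Submodule.span Aᵐᵒᵖ sX
  let LY := Submodule.span Aᵐᵒᵖ sY
  have : Module.FinitePresentation Aᵐᵒᵖ (E ⧸ LX) :=
    finitePresentation_quotient_span (R.finite_toSet.image _)
  have : Module.FinitePresentation Aᵐᵒᵖ ((E × (Fin m → A)) ⧸ LY) :=
    finitePresentation_quotient_span ((R.finite_toSet.image _).union (Set.finite_range _))
  have hf₀ : LX ≤ LinearMap.ker (LY.mkQ ∘ₗ LinearMap.inl Aᵐᵒᵖ E (Fin m → A)) := by
    rw [Submodule.span_le]
    rintro _ ⟨k, hk, rfl⟩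
    exact (Submodule.Quotient.mk_eq_zero _).2 (Submodule.subset_span (Or.inl ⟨k, hk, rfl⟩))
  let f₀ : (E ⧸ LX) →ₗ[Aᵐᵒᵖ] ((E × (Fin m → A)) ⧸ LY) := LX.liftQ _ hf₀
  let X : FPMod A := FPMod.of (E ⧸ LX)
  let Y : FPMod A := FPMod.of ((E × (Fin m → A)) ⧸ LY)
  let f : X ⟶ Y := ObjectProperty.homMk (ModuleCat.ofHom f₀)
  have hD : ∀ N, D N → InjectiveAlong f N := by
    intro N hN z
    have hz (k : relations M) (hk : k ∈ R) : z.hom (LX.mkQ (ret k.1)) = 0 := by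
      have : LX.mkQ (ret k.1) = 0 :=
        (Submodule.Quotient.mk_eq_zero _).2 (Submodule.subset_span ⟨k, hk, rfl⟩)
      rw [this]
      exact map_zero z.hom
    -- Symbols outside `s` are interpreted as zero by `ret`.
    obtain ⟨y, hy⟩ := hcon N (z.hom ∘ₗ LX.mkQ ∘ₗ ret) hN hz
    have hg : LY ≤ LinearMap.ker (LinearMap.coprod (z.hom ∘ₗ LX.mkQ) (freeLift y)) := by
      rw [Submodule.span_le]
      rintro _ (⟨k, hk, rfl⟩ | ⟨j, rfl⟩)
      · change z.hom (LX.mkQ (ret k.1)) + freeLift y (0 : Fin m → A) = 0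
        rw [hz k hk, map_zero, add_zero]
      · change z.hom (LX.mkQ (ret (Finsupp.single (x j) 1))) + freeLift y (-col j) = 0
        rw [map_neg, add_neg_eq_zero]
        exact (hy j).symm
    refine ⟨ModuleCat.ofHom (LY.liftQ _ hg), ?_⟩
    ext1
    refine LinearMap.ext fun t => ?_
    obtain ⟨t, rfl⟩ := LX.mkQ_surjective t
    change z.hom (LX.mkQ t) + freeLift y (0 : Fin m → A) = z.hom (LX.mkQ t)
    rw [map_zero, add_zero]
  have hx₀ : LX ≤ LinearMap.ker (ε ∘ₗ emb) := by
    rw [Submodule.span_le]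
    rintro _ ⟨k, hk', rfl⟩
    exact hk k hk'
  obtain ⟨y, hy⟩ := hM X Y f hD (ModuleCat.ofHom (LX.liftQ _ hx₀))
  refine hx ⟨fun i => y.hom (LY.mkQ (0, Pi.single i 1)), fun j => ?_⟩
  have h1 : y.hom (LY.mkQ (0, col j)) = ∑ i, op (U i j) • y.hom (LY.mkQ (0, Pi.single i 1)) :=
    (LinearMap.congr_fun (freeLift_eq (y.hom ∘ₗ LY.mkQ ∘ₗ LinearMap.inr Aᵐᵒᵖ E (Fin m → A)))
      (col j)).symm
  have h2 : LY.mkQ (ret (Finsupp.single (x j) 1), 0) = LY.mkQ (0, col j) := by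
    rw [← sub_eq_zero, ← map_sub, Submodule.mkQ_apply, Submodule.Quotient.mk_eq_zero]
    refine Submodule.subset_span (Or.inr ⟨j, ?_⟩)
    rw [Prod.mk_sub_mk, sub_zero, zero_sub]
  have h3 : y.hom (LY.mkQ (ret (Finsupp.single (x j) 1), 0)) = x j :=
    (ConcreteCategory.congr_hom hy (LX.mkQ (ret (Finsupp.single (x j) 1)))).trans (hxj j)
  rw [← h1, ← h2, h3]

/-- A definable subcategory contains every module which is injective with respect to all maps in
`mod-A` with respect to which the modules in `D` are injective. -/
theorem IsDefinable.prop_of_injectiveAlong {D : ObjectProperty (RMod A)} (hD : IsDefinable D)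
    {M : RMod A}
    (hM : ∀ (X Y : FPMod A) (f : X ⟶ Y), (∀ N, D N → InjectiveAlong f N) → InjectiveAlong f M) :
    D M := by
  classical
  let Sys := {σ : Σ (m n : ℕ), Matrix (Fin m) (Fin n) A × (Fin n → M) //
    ¬ ∃ z : Fin σ.1 → M, ∀ j, ∑ i, op (σ.2.2.1 i j) • z i = σ.2.2.2 j}
  choose Q q hQD hQR hQ using fun (R : Finset (relations M)) (σ : Sys) =>
    exists_not_solvable hM R σ.1.2.2.1 σ.1.2.2.2 σ.2
  -- The product over all unsolvable systems refutes them simultaneously, so a system solvable in `N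
  -- R` is solvable in `M`.
  let N (R : Finset (relations M)) : RMod A := ModuleCat.of Aᵐᵒᵖ (∀ σ : Sys, Q R σ)
  let h (R : Finset (relations M)) : (M →₀ Aᵐᵒᵖ) →ₗ[Aᵐᵒᵖ] N R := LinearMap.pi fun σ => q R σ
  have hR (R : Finset (relations M)) (k : relations M) (hk : k ∈ R) : h R k.1 = 0 :=
    funext fun σ => hQR R σ k hk
  have hsol (R : Finset (relations M)) {m n : ℕ} (U : Matrix (Fin m) (Fin n) A) (x : Fin n → M)
      (y : Fin m → N R) (hy : ∀ j, ∑ i, op (U i j) • y i = h R (Finsupp.single (x j) 1)) :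
      ∃ z : Fin m → M, ∀ j, ∑ i, op (U i j) • z i = x j := by
    by_contra hz
    let σ : Sys := ⟨⟨m, n, U, x⟩, hz⟩
    let pr : N R →ₗ[Aᵐᵒᵖ] Q R σ := LinearMap.proj σ
    refine hQ R σ ⟨fun i => pr (y i), fun j => ?_⟩
    have := congrArg pr (hy j)
    rw [map_sum] at this
    simp only [map_smul] at this
    exact this
  have hND (R : Finset (relations M)) : D (N R) := hD.prop_pi _ (hQD R)
  let F := tailProducts N
  have := hD.directLimits (Finset (relations M))
  have hC : D (colimit F) := D.prop_colimit F fun R => hD.prop_pi _ fun R' => hND R'.1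
  let h₀ : ModuleCat.of Aᵐᵒᵖ (M →₀ Aᵐᵒᵖ) ⟶ F.obj ∅ := tailLift N ∅ fun R _ => ModuleCat.ofHom (h R)
  let ε := Finsupp.linearCombination Aᵐᵒᵖ (id : M → M)
  have hε (x : M) : ε (Finsupp.single x 1) = x := by simp [ε]
  -- Each relation `k` of `M` holds from stage `{k}` on, so the interpretation descends to `M` in
  -- the colimit.
  obtain ⟨g, hg⟩ := exists_desc_of_surjective ε (fun x => ⟨_, hε x⟩) (h₀ ≫ colimit.ι F ∅).hom (by
    intro k hk
    have e : (∅ : Finset (relations M)) ≤ {⟨k, hk⟩} := Finset.empty_subset _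
    have h1 : F.map (homOfLE e) (h₀ k) = 0 :=
      funext fun R => hR R.1 ⟨k, hk⟩ (R.2 (Finset.mem_singleton_self _))
    change colimit.ι F ∅ (h₀ k) = 0
    rw [← colimit.w F (homOfLE e), ConcreteCategory.comp_apply, h1, map_zero])
  have hgx (x : M) : g x = colimit.ι F ∅ (h₀ (Finsupp.single x 1)) := by
    have := LinearMap.congr_fun hg (Finsupp.single x 1)
    rw [LinearMap.comp_apply, hε] at this
    exact this
  have hpure (m n : ℕ) (U : Matrix (Fin m) (Fin n) A) (x : Fin n → M)
      (hy : ∃ y : Fin m → (colimit F : RMod A), ∀ j, ∑ i, op (U i j) • y i = g (x j)) :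
      ∃ z : Fin m → M, ∀ j, ∑ i, op (U i j) • z i = x j := by
    obtain ⟨y, hy⟩ := hy
    obtain ⟨R, y', hy'⟩ := exists_rep_of_isColimit (colimit.isColimit F) y
    have e : (∅ : Finset (relations M)) ≤ R := Finset.empty_subset _
    obtain ⟨R', r, hr⟩ := exists_eq_zero_of_isColimit (colimit.isColimit F) (ι := Fin n)
      (fun j => ∑ i, op (U i j) • y' i - F.map (homOfLE e) (h₀ (Finsupp.single (x j) 1))) (by
        intro j
        have h1 : (colimit.cocone F).ι.app R (F.map (homOfLE e) (h₀ (Finsupp.single (x j) 1))) =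
            g (x j) := by
          rw [hgx]
          exact ConcreteCategory.congr_hom (colimit.w F (homOfLE e)) _
        rw [map_sub, map_sum, h1, ← hy j, sub_eq_zero]
        refine Finset.sum_congr rfl fun i _ => ?_
        rw [← hy' i]
        exact map_smul ((colimit.cocone F).ι.app R).hom _ _)
    let ρ : F.obj R →ₗ[Aᵐᵒᵖ] N R' := (F.map r ≫ tailProj N (le_refl R')).hom
    refine hsol R' U x (fun i => ρ (y' i)) fun j => ?_
    have h2 : ρ (∑ i, op (U i j) • y' i - F.map (homOfLE e) (h₀ (Finsupp.single (x j) 1))) = 0 :=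
      (congrArg (tailProj N (le_refl R')) (hr j)).trans (map_zero _)
    rw [map_sub, sub_eq_zero, map_sum] at h2
    simp only [map_smul] at h2
    exact h2
  refine hD.pureSubobjects (ModuleCat.ofHom g) ⟨?_, hpure⟩ hC
  change Function.Injective g
  rw [injective_iff_map_eq_zero]
  intro x hx
  -- Injectivity is the case of one equation without unknowns, `0 = x`.
  obtain ⟨z, hz⟩ := hpure 0 1 0 (fun _ => x) ⟨0, fun _ => by simp [hx]⟩
  simpa using (hz 0).symm

end Definable

/-! ### Serre subcategories under equivalences -/

section SerreEquivalence

universe u' v'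

theorem IsSerre.inverseImage {C : Type u} [Category.{v} C] [HasZeroMorphisms C] {D : Type u'}
    [Category.{v'} D] [HasZeroMorphisms D] {S : ObjectProperty D} (hS : IsSerre S) (F : C ⥤ D)
    [F.IsEquivalence] : IsSerre (S.inverseImage F) where
  containsZero := by
    obtain ⟨Z, hZ, h⟩ := hS.containsZero
    have := hS.subobjects
    have e : F.obj (F.inv.obj Z) ≅ Z := F.asEquivalence.counitIso.app Z
    refine ⟨F.inv.obj Z, ?_, S.prop_of_iso e.symm h⟩
    rw [IsZero.iff_id_eq_zero]
    refine F.map_injective ?_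
    exact (hZ.of_iso e).eq_of_src _ _
  subobjects := by
    have := hS.subobjects
    infer_instance
  quotients := by
    have := hS.quotients
    infer_instance
  extensions := by
    have := hS.extensions
    infer_instance

theorem IsSerre.op {C : Type u} [Category.{v} C] [HasZeroMorphisms C] {S : ObjectProperty C}
    (hS : IsSerre S) : IsSerre S.op where
  containsZero := by
    obtain ⟨Z, hZ, h⟩ := hS.containsZero
    exact ⟨Opposite.op Z, hZ.op, h⟩
  subobjects := ⟨fun f _ h => hS.quotients.prop_of_epi f.unop h⟩
  quotients := ⟨fun f _ h => hS.subobjects.prop_of_mono f.unop h⟩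
  extensions := ⟨fun hT h₁ h₃ => hS.extensions.prop_X₂_of_shortExact hT.unop h₃ h₁⟩

theorem IsSerre.unop {C : Type u} [Category.{v} C] [HasZeroMorphisms C] {S : ObjectProperty Cᵒᵖ}
    (hS : IsSerre S) : IsSerre S.unop where
  containsZero := by
    obtain ⟨Z, hZ, h⟩ := hS.containsZero
    exact ⟨Opposite.unop Z, hZ.unop, h⟩
  subobjects := ⟨fun f _ h => hS.quotients.prop_of_epi f.op h⟩
  quotients := ⟨fun f _ h => hS.subobjects.prop_of_mono f.op h⟩
  extensions := ⟨fun hT h₁ h₃ => hS.extensions.prop_X₂_of_shortExact hT.op h₃ h₁⟩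

end SerreEquivalence

/-! ### The correspondence -/

section Correspondence

variable {A : Type u} [Ring A]

/-- The subcategory of Adelman's category which corresponds to a subcategory of `mod-(mod-A)`. -/
def adelmanClass (S : ObjectProperty (FPFun A)) : ObjectProperty (Adelman (FreeMod A)) :=
  S.op.inverseImage (adelmanFunctor A)

theorem IsSerre.adelmanClass {S : ObjectProperty (FPFun A)} (hS : IsSerre S) :
    IsSerre (adelmanClass S) :=
  hS.op.inverseImage (adelmanFunctor A)

theorem exists_iso_chainArrow (F : FPFun A) :
    ∃ T : Adelman (FreeMod A), Nonempty (F ≅ fpCoker (chainArrow T.as)) :=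
  ⟨(adelmanFunctor A).objPreimage (Opposite.op F),
    ⟨((adelmanFunctor A).objObjPreimageIso (Opposite.op F)).unop⟩⟩

theorem IsSerre.adelmanClass_le_iff {S S' : ObjectProperty (FPFun A)} (hS : IsSerre S)
    (hS' : IsSerre S') : FreeAb.adelmanClass S ≤ FreeAb.adelmanClass S' ↔ S ≤ S' := by
  have := hS.subobjects
  have := hS'.subobjects
  refine ⟨fun h F hF => ?_, fun h T hT => h _ hT⟩
  obtain ⟨T, ⟨e⟩⟩ := exists_iso_chainArrow F
  exact S'.prop_of_iso e.symm (h T (S.prop_of_iso e hF))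

theorem IsSerre.exists_adelmanClass_eq {S : ObjectProperty (Adelman (FreeMod A))} (hS : IsSerre S) :
    ∃ S' : ObjectProperty (FPFun A), IsSerre S' ∧ FreeAb.adelmanClass S' = S := by
  have := hS.subobjects
  refine ⟨(S.inverseImage (adelmanFunctor A).inv).unop, (hS.inverseImage _).unop, ?_⟩
  ext T
  exact S.prop_iff_of_iso ((adelmanFunctor A).asEquivalence.unitIso.app T).symm

theorem kerClass_iff (S : ObjectProperty (FPFun A)) (M : RMod A) :
    kerClass S M ↔ ∀ F, S F → Vanishes F.obj M :=
  forall₂_congr fun F _ => isZero_extend_iff F.obj M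

/-- Both classes mean injectivity along the arrows `chainArrow T`, and up to isomorphism every
functor comes from such an arrow. -/
theorem IsSerre.omegaClass_adelmanClass {S : ObjectProperty (FPFun A)} (hS : IsSerre S) :
    omegaClass (FreeAb.adelmanClass S) = kerClass S := by
  have := hS.subobjects
  ext M
  rw [kerClass_iff]
  constructor
  · intro h F hF
    obtain ⟨T, ⟨e⟩⟩ := exists_iso_chainArrow F
    refine Vanishes.of_iso e.symm ((vanishes_cokerFun_iff _ M).2 ?_)
    exact (omega_iff_injectiveAlong T M).1 (h T (S.prop_of_iso e hF))
  · intro h T hT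
    exact (omega_iff_injectiveAlong T M).2 ((vanishes_cokerFun_iff _ M).1 (h _ hT))

theorem IsSerre.isDefinable_kerClass {S : ObjectProperty (FPFun A)} (hS : IsSerre S) :
    IsDefinable (kerClass S) :=
  hS.omegaClass_adelmanClass ▸ isDefinable_omegaClass _

/-- A Serre subcategory contains every functor which vanishes on its definable subcategory. -/
theorem IsSerre.annihilator_kerClass_le {S : ObjectProperty (FPFun A)} (hS : IsSerre S) :
    annihilator (kerClass S) ≤ S := by
  intro G hG
  have := hS.subobjects
  obtain ⟨X, Y, g, ⟨e⟩⟩ := exists_iso_fpCoker G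
  refine S.prop_of_iso e ?_
  by_contra hg
  obtain ⟨M, hM, hM'⟩ := hS.exists_module g hg
  refine hM' ((vanishes_cokerFun_iff g M).1 (Vanishes.of_iso e.symm (hG M ?_)))
  rw [← hS.omegaClass_adelmanClass]
  exact fun T hT => (omega_iff_injectiveAlong T M).2 (hM T.as hT)

theorem IsSerre.le_iff_kerClass_le {S S' : ObjectProperty (FPFun A)} (hS' : IsSerre S') :
    S ≤ S' ↔ kerClass S' ≤ kerClass S := by
  refine ⟨fun h M hM F hF => hM F (h F hF), fun h F hF => hS'.annihilator_kerClass_le F ?_⟩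
  exact fun M hM => (kerClass_iff S M).1 (h M hM) F hF

/-- Applied to the functors of single maps, vanishing on the annihilator is the hypothesis of
`IsDefinable.prop_of_injectiveAlong`. -/
theorem IsDefinable.kerClass_annihilator {D : ObjectProperty (RMod A)} (hD : IsDefinable D) :
    kerClass (annihilator D) = D := by
  refine le_antisymm (fun M hM => ?_) fun M hM => (kerClass_iff _ M).2 fun F hF => hF M hM
  rw [kerClass_iff] at hM
  refine hD.prop_of_injectiveAlong fun X Y f hf => ?_
  exact (vanishes_cokerFun_iff f M).1 (hM (fpCoker f) fun N hN => (vanishes_cokerFun_iff f N).2 (hf N hN))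

theorem bijOn_kerClass (A : Type u) [Ring A] :
    Set.BijOn (kerClass (A := A)) {S | IsSerre S} {D | IsDefinable D} := by
  refine ⟨fun S hS => IsSerre.isDefinable_kerClass hS, fun S hS S' hS' h => ?_, fun D hD =>
    ⟨annihilator D, isSerre_annihilator D, IsDefinable.kerClass_annihilator hD⟩⟩
  exact le_antisymm ((IsSerre.le_iff_kerClass_le hS').2 h.ge) ((IsSerre.le_iff_kerClass_le hS).2 h.le)

theorem IsSerre.le_iff_omegaClass_le {S S' : ObjectProperty (Adelman (FreeMod A))} (hS : IsSerre S)
    (hS' : IsSerre S') : S ≤ S' ↔ omegaClass S' ≤ omegaClass S := by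
  obtain ⟨S, h, rfl⟩ := hS.exists_adelmanClass_eq
  obtain ⟨S', h', rfl⟩ := hS'.exists_adelmanClass_eq
  rw [h.adelmanClass_le_iff h', h.omegaClass_adelmanClass, h'.omegaClass_adelmanClass,
    h'.le_iff_kerClass_le]

theorem bijOn_omegaClass (A : Type u) [Ring A] :
    Set.BijOn (omegaClass (A := A)) {S | IsSerre S} {D | IsDefinable D} := by
  refine ⟨fun S _ => isDefinable_omegaClass S, fun S hS S' hS' h => ?_, fun D hD => ?_⟩
  · exact le_antisymm ((IsSerre.le_iff_omegaClass_le hS hS').2 h.ge)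
      ((IsSerre.le_iff_omegaClass_le hS' hS).2 h.le)
  · refine ⟨adelmanClass (annihilator D), (isSerre_annihilator D).adelmanClass, ?_⟩
    rw [(isSerre_annihilator D).omegaClass_adelmanClass]
    exact IsDefinable.kerClass_annihilator hD

end Correspondence

end FreeAb

open FreeAb in
theorem proposition2p16 (A : Type u) [Ring A] :
    -- (1) `S ↦ ⋂_{F ∈ S} Ker F⃗` is a bijection from the Serre subcategories of `mod-(mod-A)`
    -- onto the definable subcategories of `Mod-A`
    Set.BijOn (kerClass (A := A)) {S | IsSerre S} {D | IsDefinable D} ∧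
    -- (2) `S ↦ ⋂_{𝐀 ∈ S} Ω_𝐀` is a bijection from the Serre subcategories of Adelman's category
    -- over `𝔸` onto the definable subcategories of `Mod-A`
    Set.BijOn (omegaClass (A := A)) {S | IsSerre S} {D | IsDefinable D} ∧
    -- (3) both bijections reverse inclusions
    (∀ S S' : ObjectProperty (FPFun A), IsSerre S → IsSerre S' →
      (S ≤ S' ↔ kerClass S' ≤ kerClass S)) ∧
    (∀ S S' : ObjectProperty (Adelman (FreeMod A)), IsSerre S → IsSerre S' →
      (S ≤ S' ↔ omegaClass S' ≤ omegaClass S)) :=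
  ⟨bijOn_kerClass A, bijOn_omegaClass A, fun _ _ _ hS' => hS'.le_iff_kerClass_le,
    fun _ _ hS hS' => hS.le_iff_omegaClass_le hS'⟩
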